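/- **Setting.** An agent interacts for $K$ episodes with an $H$-step Markov decision process with compact metric state space $(\mathcal S,D_{\mathcal S})$ and action space $(\mathcal A,D_{\mathcal A})$, transition kernels $T_h(\cdot\mid x,a)$ and reward distributions $R_h(x,a)$ on $[0,1]$. Let $D$ be a metric on $\mathcal S\times\mathcal A$ with $D((x,a),(x',a'))\le D_{\mathcal S}(x,x')+D_{\mathcal A}(a,a')$, and let $d_W(\mu,\nu)=\sup_f\int f\,d(\mu-\nu)$ (supremum over $1$-Lipschitz $f$) be the $1$-Wasserstein distance. Assume $d_W(T_h(\cdot\mid x,a),T_h(\cdot\mid x',a'))\le L_T\,D((x,a),(x',a'))$ for all $h\in[H]$, with $L_T\ge 0$, and let $L_V>0$, $L_r\in\mathbb R$, $\delta\in(0,1)$. *Dyadic partitions.* $\mathcal S$ has measurable nested finite partitions $\mathcal S_\ell$ ($\ell\ge0$), $\mathcal S_0=\{\mathcal S\}$, into nonempty cells $C$ of diameter at most $2^{-\ell}$ with designated centers $\tilde x(C)\in C$, each cell of $\mathcal S_\ell$ splitting into exactly $2^{d_{\mathcal S}}$ cells of $\mathcal S_{\ell+1}$; similarly $\mathcal A_\ell$,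 with $2^{d_{\mathcal A}}$ and centers $\tilde a$. A ball of level $\ell(B)=\ell$ is $B=\mathcal S(B)\times\mathcal A(B)$ with $\mathcal S(B)\in\mathcal S_\ell$, $\mathcal A(B)\in\mathcal A_\ell$; its diameter is $D(B)=2^{-\ell}$. Write $d=d_{\mathcal S}+d_{\mathcal A}$ and $\tilde a(B)=\tilde a(\mathcal A(B))$. *Algorithm (AdaMB).* Start with $\mathcal P_h^0=\{\mathcal S\times\mathcal A\}$ and $\hat Q_h^0=\tilde V_h^0=\hat V_h^0=H-h+1$. In episode $k$ the starting state $X_1^k$ is arbitrary (it may depend on the past). At step $h$ one selects among the balls $B\in\mathcal P_h^{k-1}$ with $X_h^k\in\mathcal S(B)$ a ball $B_h^k$ maximizing $\hat Q_h^{k-1}$ (ties broken arbitrarily), plays $A_h^k=\tilde a(B_h^k)$, and observes a reward $R_h^k\sim R_h(X_h^k,A_h^k)$ and $X_{h+1}^k\sim T_h(\cdot\mid X_h^k,A_h^k)$, each conditionally on the history. Let $n_h^k(B)=\#\{k'\le k:B_h^{k'}=B\}$. If $n_h^k(B_h^k)+1\ge H^{(d+d_{\mathcal S})/(d+1)}\,2^{\gamma\ell(B_h^k)}$,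 with $\gamma=d_{\mathcal S}$ if $d_{\mathcal S}>2$ and $\gamma=d_{\mathcal S}+2$ if $d_{\mathcal S}\le2$, then $\mathcal P_h^k$ arises from $\mathcal P_h^{k-1}$ by replacing $B_h^k$ with the balls of level $\ell(B_h^k)+1$ that it contains; otherwise $\mathcal P_h^k=\mathcal P_h^{k-1}$. Let $\hat r_h^k(B)$ be the average reward, and $\hat T_h^k(C\mid B)$ the fraction of next states in $C$, over the $n_h^k(B)$ plays in $B$. With sums over all balls $B'\supseteq B$ and $N_h^k(B)=\sum_{B'\supseteq B}n_h^k(B')$, put $$\bar r_h^k(B)=\frac{\sum_{B'}n_h^k(B')\,\hat r_h^k(B')}{N_h^k(B)},\qquad \bar T_h^k(C\mid B)=\frac{\sum_{B'}\sum_{C'\in\mathcal S_{\ell(B')},\,C'\supseteq C}2^{-d_{\mathcal S}(\ell(B)-\ell(B'))}\,n_h^k(B')\,\hat T_h^k(C'\mid B')}{N_h^k(B)}\quad(C\in\mathcal S_{\ell(B)}).$$ $\bar T_h^k(\cdot\mid B)$ is regarded as the measure on $\mathcal S$ with mass $\bar T_h^k(C\mid B)$ at $\tilde x(C)$. For a constant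 $c$, let $$\mathrm{Rbonus}_h^k(B)=\sqrt{\tfrac{8\log(2HK^2/\delta)}{N_h^k(B)}}+4L_rD(B),$$ $$\mathrm{Tbonus}_h^k(B)=\begin{cases}L_V\Big((5L_T+4)D(B)+4\sqrt{\tfrac{\log(HK^2/\delta)}{N_h^k(B)}}+c\,N_h^k(B)^{-1/d_{\mathcal S}}\Big)&d_{\mathcal S}>2,\\[1ex] L_V\Big((5L_T+6)D(B)+4\sqrt{\tfrac{\log(HK^2/\delta)}{N_h^k(B)}}+c\,\sqrt{\tfrac{2^{d_{\mathcal S}\ell(B)}}{N_h^k(B)}}\Big)&d_{\mathcal S}\le2.\end{cases}$$ For $k\ge1$ the estimates are updated by $\hat Q_H^k(B)=\bar r_H^k(B)+\mathrm{Rbonus}_H^k(B)$ and, for $h<H$, $$\hat Q_h^k(B)=\bar r_h^k(B)+\mathrm{Rbonus}_h^k(B)+\sum_{C\in\mathcal S_{\ell(B)}}\bar T_h^k(C\mid B)\,\hat V_{h+1}^{k-1}(\tilde x(C))+\mathrm{Tbonus}_h^k(B),$$ $$\tilde V_h^k(C)=\min\Big\{\tilde V_h^{k-1}(C),\max_{B\in\mathcal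 P_h^k,\ \mathcal S(B)\supseteq C}\hat Q_h^k(B)\Big\},\qquad \hat V_h^k(x)=\min_{C}\big(\tilde V_h^k(C)+L_V\,D_{\mathcal S}(x,\tilde x(C))\big),$$ the last minimum being over the minimal elements $C$ of $\{\mathcal S(B):B\in\mathcal P_h^k\}$. **Statement.** There is a universal constant $c>0$ such that in every such setting, if the algorithm is run with this $c$, then with probability at least $1-2\delta$, simultaneously for all $h\in[H]$, $k\in[K]$, all $B\in\mathcal P_h^k$ and all $(x,a)\in B$, $$d_W\big(\bar T_h^k(\cdot\mid B),\,T_h(\cdot\mid x,a)\big)\le\frac{1}{L_V}\,\mathrm{Tbonus}_h^k(B).$$ -/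

import Mathlib

open MeasureTheory ProbabilityTheory Set
open scoped ENNReal

namespace AdaMB

noncomputable section

open scoped Classical in
/-- A hierarchy of dyadic partitions of a metric space `X` of dimension `d`: for every level `ℓ` a
finite partition `cells ℓ` of `X` into nonempty measurable cells of diameter at most `2 ^ (-ℓ)`,
starting from the trivial partition; every level refines the previous one, every cell splits into
exactly `2 ^ d` cells of the next level, and every cell has a designated center. -/
structure DyadicPartition (X : Type*) [MetricSpace X] [MeasurableSpace X] (d : ℝ) where
  cells : ℕ → Finset (Set X)
  center : Set X → X
  cells_zero : cells 0 = {Set.univ}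
  nonempty : ∀ ℓ, ∀ C ∈ cells ℓ, C.Nonempty
  measurable : ∀ ℓ, ∀ C ∈ cells ℓ, MeasurableSet C
  cover : ∀ ℓ x, ∃ C ∈ cells ℓ, x ∈ C
  disjoint : ∀ ℓ, ∀ C ∈ cells ℓ, ∀ C' ∈ cells ℓ, C ≠ C' → Disjoint C C'
  refines : ∀ ℓ, ∀ C ∈ cells (ℓ + 1), ∃ C' ∈ cells ℓ, C ⊆ C'
  card_children : ∀ ℓ, ∀ C' ∈ cells ℓ,
    (((cells (ℓ + 1)).filter (fun C => C ⊆ C')).card : ℝ) = (2 : ℝ) ^ d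
  dist_le : ∀ ℓ, ∀ C ∈ cells ℓ, ∀ x ∈ C, ∀ y ∈ C, dist x y ≤ (2 : ℝ) ^ (-(ℓ : ℝ))
  center_mem : ∀ ℓ, ∀ C ∈ cells ℓ, center C ∈ C

/-- A metric on `S × A` with `D((x,a),(x',a')) ≤ D_S(x,x') + D_A(a,a')`. -/
structure SubadditiveMetric (S A : Type*) [MetricSpace S] [MetricSpace A] where
  D : S × A → S × A → ℝ
  eq_zero_iff : ∀ p q, D p q = 0 ↔ p = q
  symm : ∀ p q, D p q = D q p
  triangle : ∀ p q r, D p r ≤ D p q + D q r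
  le_add : ∀ p q, D p q ≤ dist p.1 q.1 + dist p.2 q.2

/-- The `1`-Wasserstein distance in its variational form
`sup_f (∫ f dμ - ∫ f dν)` over all `1`-Lipschitz functions `f`. -/
def wasserstein {X : Type*} [MetricSpace X] [MeasurableSpace X] (μ ν : Measure X) : ℝ≥0∞ :=
  ⨆ (f : X → ℝ) (_ : LipschitzWith 1 f), ENNReal.ofReal ((∫ x, f x ∂μ) - ∫ x, f x ∂ν)

/-- A ball `B = S(B) × A(B)` of the partition tree, together with its depth `ℓ(B)`. -/
@[ext] structure Ball (S A : Type*) where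
  lvl : ℕ
  st : Set S
  ac : Set A

/-- Balls carry the discrete σ-algebra. -/
instance (S A : Type*) : MeasurableSpace (Ball S A) := ⊤

/-- The subset of `S × A` given by a ball. -/
def Ball.carrier {S A : Type*} (B : Ball S A) : Set (S × A) := B.st ×ˢ B.ac

/-- The transition and reward kernels of a Markov decision process with rewards in `[0,1]`. -/
structure MDP (S A : Type*) [MeasurableSpace S] [MeasurableSpace A] where
  T : ℕ → Kernel (S × A) S
  rew : ℕ → Kernel (S × A) ℝ
  markov_T : ∀ h, IsMarkovKernel (T h)
  markov_rew : ∀ h, IsMarkovKernel (rew h)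
  rew_mem : ∀ h p, ∀ᵐ r ∂(rew h p), r ∈ Set.Icc (0 : ℝ) 1

/-- The input of the algorithm: horizon `H`, number of episodes `K`, confidence `δ`, Lipschitz
constants, the constant `c` of the transition bonus, the metric on `S × A`, and dyadic partitions
of `S` and `A` for which every level-`ℓ` ball has diameter exactly `2 ^ (-ℓ)`. -/
structure Input (S A : Type*) [MetricSpace S] [MeasurableSpace S]
    [MetricSpace A] [MeasurableSpace A] where
  H : ℕ
  K : ℕ
  δ : ℝ
  LV : ℝ
  LT : ℝ
  Lr : ℝ
  c : ℝ
  dS : ℝ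
  dA : ℝ
  metric : SubadditiveMetric S A
  partS : DyadicPartition S dS
  partA : DyadicPartition A dA
  ball_diam : ∀ ℓ, ∀ C ∈ partS.cells ℓ, ∀ C' ∈ partA.cells ℓ,
    IsLUB {r : ℝ | ∃ p ∈ C ×ˢ C', ∃ q ∈ C ×ˢ C', r = metric.D p q} ((2 : ℝ) ^ (-(ℓ : ℝ)))

/-- The observed data: `st k h = X_h^k`, the selected ball `ball k h = B_h^k`, and the reward
`rew k h = R_h^k`, where episodes `k` and steps `h` are counted from `1`. -/
structure Trajectory (S A : Type*) where
  st : ℕ → ℕ → S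
  ball : ℕ → ℕ → Ball S A
  rew : ℕ → ℕ → ℝ

section Algorithm

open scoped Classical

variable {S A : Type*} [MetricSpace S] [MeasurableSpace S] [MetricSpace A] [MeasurableSpace A]

namespace Input

/-- The balls of level `ℓ`: products of a level-`ℓ` cell of `S` and a level-`ℓ` cell of `A`. -/
def nodes (θ : Input S A) (ℓ : ℕ) : Finset (Ball S A) :=
  (θ.partS.cells ℓ ×ˢ θ.partA.cells ℓ).image (fun C => ⟨ℓ, C.1, C.2⟩)

/-- The ball `S × A`. -/
def root : Ball S A := ⟨0, Set.univ, Set.univ⟩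

/-- The `2 ^ (dS + dA)` balls into which `B` is split. -/
def children (θ : Input S A) (B : Ball S A) : Finset (Ball S A) :=
  (θ.nodes (B.lvl + 1)).filter (fun B' => B'.carrier ⊆ B.carrier)

/-- The balls `B' ⊇ B` of the tree, `B` included. -/
def ancestors (θ : Input S A) (B : Ball S A) : Finset (Ball S A) :=
  ((Finset.range (B.lvl + 1)).biUnion θ.nodes).filter (fun B' => B.carrier ⊆ B'.carrier)

/-- The diameter `D(B)`. -/
def diam (θ : Input S A) (B : Ball S A) : ℝ :=
  sSup {r : ℝ | ∃ p ∈ B.carrier, ∃ q ∈ B.carrier, r = θ.metric.D p q}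

/-- The action `ã(B)` played in the ball `B`. -/
def action (θ : Input S A) (B : Ball S A) : A := θ.partA.center B.ac

/-- The exponent of the splitting threshold. -/
def γ (θ : Input S A) : ℝ := if 2 < θ.dS then θ.dS else θ.dS + 2

/-- The factor `φ = H ^ ((d + dS) / (d + 1))` of the splitting threshold, `d = dS + dA`. -/
def φ (θ : Input S A) : ℝ :=
  (θ.H : ℝ) ^ ((θ.dS + θ.dA + θ.dS) / (θ.dS + θ.dA + 1))

/-- The splitting threshold `n_+(B) = φ 2 ^ (γ ℓ(B))`. -/
def nPlus (θ : Input S A) (B : Ball S A) : ℝ := θ.φ * (2 : ℝ) ^ (θ.γ * (B.lvl : ℝ))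

/-- The episodes `k' ≤ k` in which the ball `B` is selected at step `h`. -/
def visits (τ : Trajectory S A) (h k : ℕ) (B : Ball S A) : Finset ℕ :=
  (Finset.Icc 1 k).filter (fun k' => τ.ball k' h = B)

/-- The count `n_h^k(B)`. -/
def n (τ : Trajectory S A) (h k : ℕ) (B : Ball S A) : ℕ := (visits τ h k B).card

/-- The partition `P_h^k` at the end of episode `k`: in every episode, the selected ball is
replaced by its children once `n_h^k(B) + 1 ≥ n_+(B)`. -/
def partition (θ : Input S A) (τ : Trajectory S A) (h : ℕ) : ℕ → Finset (Ball S A)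
  | 0 => {root}
  | k + 1 =>
    if θ.nPlus (τ.ball (k + 1) h) ≤ (n τ h (k + 1) (τ.ball (k + 1) h) : ℝ) + 1 then
      (partition θ τ h k).erase (τ.ball (k + 1) h) ∪ θ.children (τ.ball (k + 1) h)
    else partition θ τ h k

/-- The partition of the state space induced by a partition `P` of `S × A`: the minimal elements
among the sets `S(B)`, `B ∈ P`. -/
def inducedPartition (P : Finset (Ball S A)) : Finset (Set S) :=
  (P.image Ball.st).filter (fun C => ∀ B' ∈ P, ¬ B'.st ⊂ C)

/-- `∑_{B' ⊇ B} n_h^k(B')`. -/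
def nBar (θ : Input S A) (τ : Trajectory S A) (h k : ℕ) (B : Ball S A) : ℕ :=
  ∑ B' ∈ θ.ancestors B, n τ h k B'

/-- The empirical reward of the plays in `B` (zero if there are none). -/
def rHat (τ : Trajectory S A) (h k : ℕ) (B : Ball S A) : ℝ :=
  (∑ k' ∈ visits τ h k B, τ.rew k' h) / n τ h k B

/-- The empirical fraction of the plays in `B` with next state in `C` (zero if there are none). -/
def tHat (τ : Trajectory S A) (h k : ℕ) (C : Set S) (B : Ball S A) : ℝ :=
  (((visits τ h k B).filter (fun k' => τ.st k' (h + 1) ∈ C)).card : ℝ) / n τ h k B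

/-- The reward estimate aggregated over `B` and its ancestors. -/
def rBar (θ : Input S A) (τ : Trajectory S A) (h k : ℕ) (B : Ball S A) : ℝ :=
  (∑ B' ∈ θ.ancestors B, rHat τ h k B' * n τ h k B') / θ.nBar τ h k B

/-- The mass that the aggregated transition estimate of `B` gives to a level-`ℓ(B)` cell `C`: the
mass of a coarser cell of an ancestor is split equally among its level-`ℓ(B)` subcells. -/
def tBar (θ : Input S A) (τ : Trajectory S A) (h k : ℕ) (C : Set S) (B : Ball S A) : ℝ :=
  (∑ B' ∈ θ.ancestors B, ∑ C' ∈ (θ.partS.cells B'.lvl).filter (fun C' => C ⊆ C'),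
    (2 : ℝ) ^ (-(θ.dS * ((B.lvl : ℝ) - (B'.lvl : ℝ)))) * n τ h k B' * tHat τ h k C' B') /
    θ.nBar τ h k B

/-- The aggregated transition estimate as a measure on `S`, carried by the centers of the
level-`ℓ(B)` cells. -/
def tBarMeasure (θ : Input S A) (τ : Trajectory S A) (h k : ℕ) (B : Ball S A) : Measure S :=
  ∑ C ∈ θ.partS.cells B.lvl,
    ENNReal.ofReal (θ.tBar τ h k C B) • Measure.dirac (θ.partS.center C)

/-- The reward bonus. -/
def rBonus (θ : Input S A) (τ : Trajectory S A) (h k : ℕ) (B : Ball S A) : ℝ :=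
  √(8 * Real.log (2 * θ.H * θ.K ^ 2 / θ.δ) / θ.nBar τ h k B) + 4 * θ.Lr * θ.diam B

/-- The transition bonus. -/
def tBonus (θ : Input S A) (τ : Trajectory S A) (h k : ℕ) (B : Ball S A) : ℝ :=
  if 2 < θ.dS then
    θ.LV * ((5 * θ.LT + 4) * θ.diam B
      + 4 * √(Real.log (θ.H * θ.K ^ 2 / θ.δ) / θ.nBar τ h k B)
      + θ.c * (θ.nBar τ h k B : ℝ) ^ (-(1 / θ.dS)))
  else
    θ.LV * ((5 * θ.LT + 6) * θ.diam B
      + 4 * √(Real.log (θ.H * θ.K ^ 2 / θ.δ) / θ.nBar τ h k B)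
      + θ.c * √((2 : ℝ) ^ (θ.dS * (B.lvl : ℝ)) / θ.nBar τ h k B))

/-- The initial value `H - h + 1` of all estimates at step `h`. -/
def initVal (θ : Input S A) (h : ℕ) : ℝ := (θ.H : ℝ) - h + 1

/-- The Lipschitz extension `V̂_h^k` of the values `v` on the cells of the induced partition
(`H - h + 1` before the first episode). -/
def lipExt (θ : Input S A) (τ : Trajectory S A) (v : ℕ → Set S → ℝ) (h k : ℕ) (x : S) : ℝ :=
  if k = 0 then θ.initVal h
  else sInf ((fun C => v h C + θ.LV * dist x (θ.partS.center C)) ''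
    (inducedPartition (θ.partition τ h k) : Set (Set S)))

/-- The one-step update that gives `Q̂_h^{k+1}(B)` from the values `v = Ṽ^k` after episode `k`. -/
def qUpdate (θ : Input S A) (τ : Trajectory S A) (v : ℕ → Set S → ℝ) (h k : ℕ)
    (B : Ball S A) : ℝ :=
  if h = θ.H then θ.rBar τ h (k + 1) B + θ.rBonus τ h (k + 1) B
  else θ.rBar τ h (k + 1) B + θ.rBonus τ h (k + 1) B
    + (∑ C ∈ θ.partS.cells B.lvl,
        θ.tBar τ h (k + 1) C B * θ.lipExt τ v (h + 1) k (θ.partS.center C))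
    + θ.tBonus τ h (k + 1) B

/-- The value estimates `Ṽ_h^k(C)` of state cells. A cell that enters the induced partition by a
split inherits the value of the cell that contains it, since both have the same history. -/
def vTilde (θ : Input S A) (τ : Trajectory S A) : ℕ → ℕ → Set S → ℝ
  | 0 => fun h _ => θ.initVal h
  | k + 1 => fun h C => min (vTilde θ τ k h C)
      (sSup ((fun B => θ.qUpdate τ (vTilde θ τ k) h k B) ''
        {B : Ball S A | B ∈ θ.partition τ h (k + 1) ∧ C ⊆ B.st}))

/-- The optimistic estimates `Q̂_h^k(B)`. -/
def qHat (θ : Input S A) (τ : Trajectory S A) (h : ℕ) : ℕ → Ball S A → ℝ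
  | 0 => fun _ => θ.initVal h
  | k + 1 => fun B => θ.qUpdate τ (θ.vTilde τ k) h k B

/-- The balls of `P_h^{k-1}` that are relevant for the state `x` in episode `k`. -/
def relevant (θ : Input S A) (τ : Trajectory S A) (h k : ℕ) (x : S) : Set (Ball S A) :=
  {B | B ∈ θ.partition τ h (k - 1) ∧ ∃ a, (x, a) ∈ B.carrier}

/-- The greedy selection rule, ties being broken arbitrarily: `B_h^k` is relevant for `X_h^k` and
maximizes `Q̂_h^{k-1}` among the relevant balls. -/
def Greedy (θ : Input S A) (τ : Trajectory S A) (h k : ℕ) : Prop :=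
  τ.ball k h ∈ θ.relevant τ h k (τ.st k h) ∧
    ∀ B ∈ θ.relevant τ h k (τ.st k h), θ.qHat τ h (k - 1) B ≤ θ.qHat τ h (k - 1) (τ.ball k h)

end Input

end Algorithm

/-- The random data of the interaction of the algorithm with the environment: the states `X_h^k`,
the selected balls `B_h^k` and the rewards `R_h^k` as functions on `Ω`. -/
structure Run (Ω S A : Type*) where
  X : ℕ → ℕ → Ω → S
  B : ℕ → ℕ → Ω → Ball S A
  R : ℕ → ℕ → Ω → ℝ

namespace Run

/-- The realized trajectory. -/
def traj {Ω S A : Type*} (ρ : Run Ω S A) (ω : Ω) : Trajectory S A where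
  st k h := ρ.X k h ω
  ball k h := ρ.B k h ω
  rew k h := ρ.R k h ω

/-- The history at the moment when the action of episode `k`, step `h` is played: the σ-algebra
generated by all states and selected balls up to `(k, h)` and all rewards before `(k, h)`. -/
@[reducible] def history {Ω S A : Type*} [MeasurableSpace S] (ρ : Run Ω S A) (H k h : ℕ) :
    MeasurableSpace Ω :=
  (⨆ (k' : ℕ) (h' : ℕ) (_ : 1 ≤ k' ∧ 1 ≤ h' ∧ h' ≤ H + 1 ∧ (k' < k ∨ k' = k ∧ h' ≤ h)),
      MeasurableSpace.comap (ρ.X k' h') inferInstance) ⊔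
  (⨆ (k' : ℕ) (h' : ℕ) (_ : 1 ≤ k' ∧ 1 ≤ h' ∧ h' ≤ H ∧ (k' < k ∨ k' = k ∧ h' ≤ h)),
      MeasurableSpace.comap (ρ.B k' h') inferInstance) ⊔
  (⨆ (k' : ℕ) (h' : ℕ) (_ : 1 ≤ k' ∧ 1 ≤ h' ∧ h' ≤ H ∧ (k' < k ∨ k' = k ∧ h' < h)),
      MeasurableSpace.comap (ρ.R k' h') inferInstance)

end Run

/-- `ρ` is a run of the algorithm on the Markov decision process `M`: the selected balls obey the
greedy rule, and given the history, the reward and the next state of episode `k`, step `h` are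
distributed according to `M` at the state `X_h^k` and the action `ã(B_h^k)`. The starting states
`X_1^k` are arbitrary, and may depend on the past. -/
structure IsRun {Ω S A : Type*} [MeasurableSpace Ω]
    [MetricSpace S] [MeasurableSpace S] [MetricSpace A] [MeasurableSpace A]
    (θ : Input S A) (M : MDP S A) (μ : Measure Ω) (ρ : Run Ω S A) : Prop where
  measurable_X : ∀ k h, Measurable (ρ.X k h)
  measurable_B : ∀ k h, Measurable (ρ.B k h)
  measurable_R : ∀ k h, Measurable (ρ.R k h)
  greedy : ∀ᵐ ω ∂μ, ∀ k ∈ Finset.Icc 1 θ.K, ∀ h ∈ Finset.Icc 1 θ.H, θ.Greedy (ρ.traj ω) h k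
  reward : ∀ k ∈ Finset.Icc 1 θ.K, ∀ h ∈ Finset.Icc 1 θ.H, ∀ E : Set ℝ, MeasurableSet E →
    μ⟦ρ.R k h ⁻¹' E | ρ.history θ.H k h⟧ =ᵐ[μ]
      fun ω => (M.rew h (ρ.X k h ω, θ.action (ρ.B k h ω))).real E
  transition : ∀ k ∈ Finset.Icc 1 θ.K, ∀ h ∈ Finset.Icc 1 θ.H, ∀ E : Set S, MeasurableSet E →
    μ⟦ρ.X k (h + 1) ⁻¹' E | ρ.history θ.H k h⟧ =ᵐ[μ]
      fun ω => (M.T h (ρ.X k h ω, θ.action (ρ.B k h ω))).real E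

end

end AdaMB

/-! Fix a ball `B` and a 1-Lipschitz `f`. The aggregated estimate is an average over the `N` plays
in balls containing `B`, where the next state seen in an ancestor `B'` is spread evenly over the
level-`ℓ(B)` subcells of its level-`ℓ(B')` cell. So `∫ f` against the estimate exceeds the average
of `f` over the observed next states by at most the average of `2^(-ℓ(B'))`
(`integral_tBarMeasure_le`). Replacing the law of each next state by `T_h(x, a)` costs `L_T` times
the same average. The splitting threshold at least quadruples per level, so the play counts grow at
least threefold along the split ancestors of `B`, and that average is at most `4 D(B)`
(`sum_allVisits_pow_le`).

What remains is the fluctuation `∑ (f(X) - E f(X))` over the plays. Approximating `f` by step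
functions on dyadic cells bounds it by the total variations of the empirical deviation on the cells.
For `d_S ≤ 2` the single scale `ℓ(B)` suffices; for `d_S > 2` the scales are chained
(`deviation_le_chaining`). The variation at one scale is at most twice the largest deviation on a
union of cells (`variation_le`).

The deviation on a fixed union is controlled by an exponential supermartingale
(`measureReal_adaptive_hoeffding`), with a confidence exponent that pays for all `2^#cells` unions.
Concentration is applied to each selected ball separately, a ball being identified by the episode of
its first selection, so that the union bound is polynomial in `K` although the tree is infinite.
Geometric growth of the counts gives `∑ √n(B') ≤ 2.6 √N`, so adding up the ancestors costs only a
constant. -/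

namespace AdaMB

open scoped Classical

/-! ### Dyadic partitions: nesting and cell counts. -/

namespace DyadicPartition

variable {X : Type*} [MetricSpace X] [MeasurableSpace X] {d : ℝ}

theorem cell_unique (P : DyadicPartition X d) {ℓ : ℕ} {C C' : Set X} {x : X}
    (hC : C ∈ P.cells ℓ) (hC' : C' ∈ P.cells ℓ) (hx : x ∈ C) (hx' : x ∈ C') : C = C' := by
  by_contra h
  exact Set.disjoint_left.1 (P.disjoint ℓ C hC C' hC' h) hx hx'

theorem exists_coarser (P : DyadicPartition X d) {i ℓ : ℕ} (h : i ≤ ℓ) :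
    ∀ C ∈ P.cells ℓ, ∃ C' ∈ P.cells i, C ⊆ C' := by
  induction ℓ, h using Nat.le_induction with
  | base => exact fun C hC => ⟨C, hC, subset_rfl⟩
  | succ ℓ _ ih =>
    intro C hC
    obtain ⟨C₁, h₁, hs⟩ := P.refines ℓ C hC
    obtain ⟨C₂, h₂, hs'⟩ := ih C₁ h₁
    exact ⟨C₂, h₂, hs.trans hs'⟩

theorem subset_of_mem (P : DyadicPartition X d) {i ℓ : ℕ} (h : i ≤ ℓ) {C C' : Set X} {x : X}
    (hC : C ∈ P.cells ℓ) (hC' : C' ∈ P.cells i) (hx : x ∈ C) (hx' : x ∈ C') : C ⊆ C' := by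
  obtain ⟨C₁, h₁, hs⟩ := P.exists_coarser h C hC
  rwa [P.cell_unique hC' h₁ hx' (hs hx)]

theorem card_descendants (P : DyadicPartition X d) {i ℓ : ℕ} (h : i ≤ ℓ) {C' : Set X}
    (hC' : C' ∈ P.cells i) :
    (((P.cells ℓ).filter (fun C => C ⊆ C')).card : ℝ) = ((2 : ℝ) ^ d) ^ (ℓ - i) := by
  induction ℓ, h using Nat.le_induction with
  | base =>
    have : (P.cells i).filter (fun C => C ⊆ C') = {C'} := by
      ext C
      simp only [Finset.mem_filter, Finset.mem_singleton]
      refine ⟨fun ⟨hC, hs⟩ => ?_, by rintro rfl; exact ⟨hC', subset_rfl⟩⟩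
      obtain ⟨x, hx⟩ := P.nonempty i C hC
      exact P.cell_unique hC hC' hx (hs hx)
    simp [this]
  | succ ℓ hle ih =>
    have hU : (P.cells (ℓ + 1)).filter (fun C => C ⊆ C') =
        ((P.cells ℓ).filter (fun C => C ⊆ C')).biUnion
          (fun C₁ => (P.cells (ℓ + 1)).filter (fun C => C ⊆ C₁)) := by
      ext C
      simp only [Finset.mem_filter, Finset.mem_biUnion]
      constructor
      · rintro ⟨hC, hs⟩
        obtain ⟨C₁, h₁, hs₁⟩ := P.refines ℓ C hC
        obtain ⟨x, hx⟩ := P.nonempty _ C hC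
        exact ⟨C₁, ⟨h₁, P.subset_of_mem hle h₁ hC' (hs₁ hx) (hs hx)⟩, hC, hs₁⟩
      · rintro ⟨C₁, ⟨h₁, hs₁⟩, hC, hs⟩
        exact ⟨hC, hs.trans hs₁⟩
    rw [hU, Finset.card_biUnion]
    · push_cast
      rw [Finset.sum_congr rfl (fun C₁ h₁ => P.card_children ℓ C₁ (Finset.mem_filter.1 h₁).1),
        Finset.sum_const, nsmul_eq_mul, ih, Nat.sub_add_comm hle, pow_succ]
    · intro C₁ h₁ C₂ h₂ hne
      rw [Function.onFun, Finset.disjoint_left]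
      intro C hC₁ hC₂
      simp only [Finset.coe_filter, Set.mem_ofPred_eq, Finset.mem_filter] at hC₁ hC₂ h₁ h₂
      obtain ⟨x, hx⟩ := P.nonempty _ C hC₁.1
      exact hne (P.cell_unique h₁.1 h₂.1 (hC₁.2 hx) (hC₂.2 hx))

theorem card_cells (P : DyadicPartition X d) (ℓ : ℕ) :
    ((P.cells ℓ).card : ℝ) = ((2 : ℝ) ^ d) ^ ℓ := by
  have := P.card_descendants (Nat.zero_le ℓ) (C' := Set.univ) (by simp [P.cells_zero])
  simpa using this

/-- The real number `d` is only constrained through `2 ^ d` being a cell count. Integrality later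
separates `2 ^ d` from `4` when `d > 2`. -/
theorem exists_nat_eq_two_rpow (P : DyadicPartition X d) :
    ∃ q : ℕ, 1 ≤ q ∧ (q : ℝ) = (2 : ℝ) ^ d := by
  refine ⟨(P.cells 1).card, ?_, by simpa using P.card_cells 1⟩
  have := P.card_cells 1
  have h2 : (0 : ℝ) < 2 ^ d := by positivity
  rw [Nat.one_le_iff_ne_zero]
  intro h0
  simp [h0] at this
  linarith

theorem dim_nonneg (P : DyadicPartition X d) : 0 ≤ d := by
  obtain ⟨q, hq, h⟩ := P.exists_nat_eq_two_rpow
  have : (1 : ℝ) ≤ 2 ^ d := by rw [← h]; exact_mod_cast hq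
  by_contra! hd
  have := Real.rpow_lt_one_of_one_lt_of_neg (by norm_num : (1 : ℝ) < 2) hd
  linarith

theorem dist_le_pow (P : DyadicPartition X d) {ℓ : ℕ} {C : Set X} (hC : C ∈ P.cells ℓ) {x y : X}
    (hx : x ∈ C) (hy : y ∈ C) : dist x y ≤ (1 / 2 : ℝ) ^ ℓ := by
  have := P.dist_le ℓ C hC x hx y hy
  rwa [Real.rpow_neg (by norm_num), Real.rpow_natCast, ← inv_pow, inv_eq_one_div] at this

/-- The cell of level `ℓ` that contains `x`. -/
noncomputable def cellOf (P : DyadicPartition X d) (ℓ : ℕ) (x : X) : Set X :=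
  (P.cover ℓ x).choose

theorem cellOf_mem (P : DyadicPartition X d) (ℓ : ℕ) (x : X) : P.cellOf ℓ x ∈ P.cells ℓ :=
  (P.cover ℓ x).choose_spec.1

theorem mem_cellOf (P : DyadicPartition X d) (ℓ : ℕ) (x : X) : x ∈ P.cellOf ℓ x :=
  (P.cover ℓ x).choose_spec.2

theorem cellOf_eq (P : DyadicPartition X d) {ℓ : ℕ} {x : X} {C : Set X} (hC : C ∈ P.cells ℓ)
    (hx : x ∈ C) : P.cellOf ℓ x = C :=
  P.cell_unique (P.cellOf_mem ℓ x) hC (P.mem_cellOf ℓ x) hx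

theorem mem_iff_cellOf_eq (P : DyadicPartition X d) {ℓ : ℕ} {x : X} {C : Set X}
    (hC : C ∈ P.cells ℓ) : x ∈ C ↔ P.cellOf ℓ x = C :=
  ⟨P.cellOf_eq hC, fun h => h ▸ P.mem_cellOf ℓ x⟩

theorem dist_center_le (P : DyadicPartition X d) (ℓ : ℕ) (x : X) :
    dist x (P.center (P.cellOf ℓ x)) ≤ (1 / 2 : ℝ) ^ ℓ :=
  P.dist_le_pow (P.cellOf_mem ℓ x) (P.mem_cellOf ℓ x) (P.center_mem ℓ _ (P.cellOf_mem ℓ x))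

theorem dist_le_one (P : DyadicPartition X d) (x y : X) : dist x y ≤ 1 := by
  have := P.dist_le_pow (ℓ := 0) (C := Set.univ) (by simp [P.cells_zero]) (mem_univ x) (mem_univ y)
  simpa using this

end DyadicPartition

theorem SubadditiveMetric.nonneg {S A : Type*} [MetricSpace S] [MetricSpace A]
    (m : SubadditiveMetric S A) (p q : S × A) : 0 ≤ m.D p q := by
  have h1 := m.triangle p q p
  rw [(m.eq_zero_iff p p).2 rfl, m.symm q p] at h1
  linarith

/-! ### The tree of balls, visit counts and the splitting rule. -/

namespace Input

section Counts

variable {S A : Type*}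

theorem n_succ (τ : Trajectory S A) (h k : ℕ) (B : Ball S A) :
    n τ h (k + 1) B = n τ h k B + if τ.ball (k + 1) h = B then 1 else 0 := by
  have hI : Finset.Icc 1 (k + 1) = insert (k + 1) (Finset.Icc 1 k) := by
    ext; simp; omega
  unfold n visits
  rw [hI, Finset.filter_insert]
  split_ifs
  · rw [Finset.card_insert_of_notMem (by simp)]
  · rfl

theorem n_mono (τ : Trajectory S A) (h : ℕ) (B : Ball S A) : Monotone fun k => n τ h k B :=
  monotone_nat_of_le_succ fun k => by rw [n_succ]; omega

end Counts

variable {S A : Type*} [MetricSpace S] [MeasurableSpace S] [MetricSpace A] [MeasurableSpace A]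

theorem mem_nodes {θ : Input S A} {ℓ : ℕ} {B : Ball S A} :
    B ∈ θ.nodes ℓ ↔ B.lvl = ℓ ∧ B.st ∈ θ.partS.cells ℓ ∧ B.ac ∈ θ.partA.cells ℓ := by
  simp only [nodes, Finset.mem_image, Finset.mem_product, Prod.exists]
  constructor
  · rintro ⟨C, C', ⟨h, h'⟩, rfl⟩
    exact ⟨rfl, h, h'⟩
  · rintro ⟨rfl, h, h'⟩
    exact ⟨B.st, B.ac, ⟨h, h'⟩, rfl⟩

theorem carrier_nonempty {θ : Input S A} {ℓ : ℕ} {B : Ball S A} (hB : B ∈ θ.nodes ℓ) :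
    B.carrier.Nonempty := by
  obtain ⟨-, h, h'⟩ := mem_nodes.1 hB
  exact (θ.partS.nonempty _ _ h).prod (θ.partA.nonempty _ _ h')

theorem node_unique {θ : Input S A} {ℓ : ℕ} {B B' : Ball S A} (hB : B ∈ θ.nodes ℓ)
    (hB' : B' ∈ θ.nodes ℓ) {p : S × A} (hp : p ∈ B.carrier) (hp' : p ∈ B'.carrier) : B = B' := by
  obtain ⟨h0, h1, h2⟩ := mem_nodes.1 hB
  obtain ⟨h0', h1', h2'⟩ := mem_nodes.1 hB'
  ext1
  · rw [h0, h0']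
  · exact θ.partS.cell_unique h1 h1' hp.1 hp'.1
  · exact θ.partA.cell_unique h2 h2' hp.2 hp'.2

theorem exists_coarser_node {θ : Input S A} {i ℓ : ℕ} (h : i ≤ ℓ) {B : Ball S A}
    (hB : B ∈ θ.nodes ℓ) : ∃ B' ∈ θ.nodes i, B.carrier ⊆ B'.carrier := by
  obtain ⟨-, h1, h2⟩ := mem_nodes.1 hB
  obtain ⟨C, hC, hs⟩ := θ.partS.exists_coarser h _ h1
  obtain ⟨C', hC', hs'⟩ := θ.partA.exists_coarser h _ h2
  exact ⟨⟨i, C, C'⟩, mem_nodes.2 ⟨rfl, hC, hC'⟩, Set.prod_mono hs hs'⟩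

/-- The ball of level `i` that contains `B` (for `i ≤ ℓ(B)`). -/
noncomputable def anc (θ : Input S A) (B : Ball S A) (i : ℕ) : Ball S A :=
  if h : ∃ B' ∈ θ.nodes i, B.carrier ⊆ B'.carrier then h.choose else B

theorem anc_spec {θ : Input S A} {B : Ball S A} {ℓ i : ℕ} (hB : B ∈ θ.nodes ℓ) (hi : i ≤ ℓ) :
    θ.anc B i ∈ θ.nodes i ∧ B.carrier ⊆ (θ.anc B i).carrier := by
  have h := exists_coarser_node hi hB
  rw [anc, dif_pos h]
  exact h.choose_spec

theorem anc_lvl {θ : Input S A} {B : Ball S A} {ℓ i : ℕ} (hB : B ∈ θ.nodes ℓ) (hi : i ≤ ℓ) :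
    (θ.anc B i).lvl = i :=
  (mem_nodes.1 (anc_spec hB hi).1).1

theorem anc_eq {θ : Input S A} {B B' : Ball S A} {ℓ i : ℕ} (hB : B ∈ θ.nodes ℓ) (hi : i ≤ ℓ)
    (hB' : B' ∈ θ.nodes i) (hs : B.carrier ⊆ B'.carrier) : θ.anc B i = B' := by
  obtain ⟨p, hp⟩ := carrier_nonempty hB
  exact node_unique (anc_spec hB hi).1 hB' ((anc_spec hB hi).2 hp) (hs hp)

theorem anc_self {θ : Input S A} {B : Ball S A} {ℓ : ℕ} (hB : B ∈ θ.nodes ℓ) :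
    θ.anc B ℓ = B :=
  anc_eq hB le_rfl hB subset_rfl

theorem anc_anc {θ : Input S A} {B B' : Ball S A} {i ℓ ℓ' : ℕ} (hB : B ∈ θ.nodes ℓ)
    (hB' : B' ∈ θ.nodes ℓ') (hs : B.carrier ⊆ B'.carrier) (hi : i ≤ ℓ') (hle : ℓ' ≤ ℓ) :
    θ.anc B i = θ.anc B' i :=
  anc_eq hB (hi.trans hle) (anc_spec hB' hi).1 (hs.trans (anc_spec hB' hi).2)

/-- A node has exactly one ancestor per level, so sums over ancestors become sums over levels. -/
theorem sum_ancestors {θ : Input S A} {B : Ball S A} {ℓ : ℕ} (hB : B ∈ θ.nodes ℓ)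
    {M : Type*} [AddCommMonoid M] (F : Ball S A → M) :
    ∑ B' ∈ θ.ancestors B, F B' = ∑ i ∈ Finset.range (ℓ + 1), F (θ.anc B i) := by
  have hl := (mem_nodes.1 hB).1
  have : θ.ancestors B = (Finset.range (ℓ + 1)).image (θ.anc B) := by
    ext B'
    simp only [ancestors, Finset.mem_filter, Finset.mem_biUnion, Finset.mem_image,
      Finset.mem_range, hl]
    constructor
    · rintro ⟨⟨i, hi, h⟩, hs⟩
      exact ⟨i, hi, anc_eq hB (Nat.lt_succ_iff.1 hi) h hs⟩
    · rintro ⟨i, hi, rfl⟩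
      have := anc_spec hB (Nat.lt_succ_iff.1 hi)
      exact ⟨⟨i, hi, this.1⟩, this.2⟩
  rw [this, Finset.sum_image]
  intro i hi j hj hij
  simp only [Finset.coe_range, Set.mem_Iio] at hi hj
  have h1 := anc_lvl hB (Nat.lt_succ_iff.1 hi)
  have h2 := anc_lvl hB (Nat.lt_succ_iff.1 hj)
  rw [← h1, ← h2, hij]

theorem diam_eq {θ : Input S A} {B : Ball S A} {ℓ : ℕ} (hB : B ∈ θ.nodes ℓ) :
    θ.diam B = (1 / 2 : ℝ) ^ ℓ := by
  obtain ⟨-, h1, h2⟩ := mem_nodes.1 hB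
  obtain ⟨p, hp⟩ := carrier_nonempty hB
  have := (θ.ball_diam ℓ _ h1 _ h2).csSup_eq ⟨_, p, hp, p, hp, rfl⟩
  rw [diam, Ball.carrier, this, Real.rpow_neg (by norm_num), Real.rpow_natCast, ← inv_pow,
    inv_eq_one_div]

theorem metric_le {θ : Input S A} {B : Ball S A} {ℓ : ℕ} (hB : B ∈ θ.nodes ℓ) {p q : S × A}
    (hp : p ∈ B.carrier) (hq : q ∈ B.carrier) : θ.metric.D p q ≤ (1 / 2 : ℝ) ^ ℓ := by
  obtain ⟨-, h1, h2⟩ := mem_nodes.1 hB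
  have := (θ.ball_diam ℓ _ h1 _ h2).1 ⟨p, hp, q, hq, rfl⟩
  rwa [Real.rpow_neg (by norm_num), Real.rpow_natCast, ← inv_pow, inv_eq_one_div] at this

/-! ### The invariants of the partitions -/

theorem one_le_nPlus (θ : Input S A) (hH : 1 ≤ θ.H) (B : Ball S A) : 1 ≤ θ.nPlus B := by
  have h1 := θ.partS.dim_nonneg
  have h2 := θ.partA.dim_nonneg
  have hφ : 1 ≤ θ.φ := Real.one_le_rpow (by exact_mod_cast hH) (by positivity)
  have hγ : 0 ≤ θ.γ := by unfold γ; split_ifs <;> linarith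
  have : (1 : ℝ) ≤ 2 ^ (θ.γ * (B.lvl : ℝ)) := Real.one_le_rpow (by norm_num) (by positivity)
  exact one_le_mul_of_one_le_of_one_le hφ this

/-- In both regimes `γ ≥ 2`, whence the factor `2 ^ γ ≥ 4`. -/
theorem four_mul_nPlus_le (θ : Input S A) (hH : 1 ≤ θ.H) {B B' : Ball S A}
    (h : B'.lvl = B.lvl + 1) : 4 * θ.nPlus B ≤ θ.nPlus B' := by
  have h1 := θ.partS.dim_nonneg
  have h2 := θ.partA.dim_nonneg
  have hφ : 1 ≤ θ.φ := Real.one_le_rpow (by exact_mod_cast hH) (by positivity)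
  have hγ : 2 ≤ θ.γ := by unfold γ; split_ifs <;> linarith
  have h4 : (4 : ℝ) ≤ 2 ^ θ.γ := by
    calc (4 : ℝ) = 2 ^ (2 : ℝ) := by norm_num
      _ ≤ _ := Real.rpow_le_rpow_of_exponent_le (by norm_num) hγ
  have hx : (0 : ℝ) < 2 ^ (θ.γ * (B.lvl : ℝ)) := by positivity
  unfold nPlus
  rw [h]
  push_cast
  rw [mul_add, mul_one, Real.rpow_add (by norm_num)]
  have : 0 ≤ θ.φ * (2 : ℝ) ^ (θ.γ * (B.lvl : ℝ)) := by positivity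
  nlinarith

/-- The ball `B` satisfies the splitting criterion after episode `k`. -/
def HasSplit (θ : Input S A) (τ : Trajectory S A) (h k : ℕ) (B : Ball S A) : Prop :=
  -- The first conjunct matters: when `n_+(B) = 1`, an unplayed ball already satisfies the
  -- inequality, but the algorithm tests it only after a play.
  1 ≤ n τ h k B ∧ θ.nPlus B ≤ (n τ h k B : ℝ) + 1

theorem HasSplit.mono {θ : Input S A} {τ : Trajectory S A} {h k k' : ℕ} {B : Ball S A}
    (hB : HasSplit θ τ h k B) (hk : k ≤ k') : HasSplit θ τ h k' B := by
  have := n_mono τ h B hk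
  refine ⟨hB.1.trans this, hB.2.trans ?_⟩
  have : (n τ h k B : ℝ) ≤ n τ h k' B := by exact_mod_cast this
  linarith

theorem root_mem_nodes (θ : Input S A) : root ∈ θ.nodes 0 := by
  simp [mem_nodes, root, θ.partS.cells_zero, θ.partA.cells_zero]

theorem partition_invariant (θ : Input S A) (τ : Trajectory S A) (h K : ℕ)
    (hsel : ∀ k < K, τ.ball (k + 1) h ∈ θ.partition τ h k) (k : ℕ) (hk : k ≤ K) :
    (∀ B ∈ θ.partition τ h k, B ∈ θ.nodes B.lvl ∧
      (∀ i < B.lvl, HasSplit θ τ h k (θ.anc B i)) ∧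
      (n τ h k B = 0 ∨ (n τ h k B : ℝ) + 1 < θ.nPlus B)) ∧
    (∀ k' < k, ∀ i < (τ.ball (k' + 1) h).lvl, HasSplit θ τ h k (θ.anc (τ.ball (k' + 1) h) i)) ∧
    (∀ B, n τ h k B ≤ 1 ∨ (n τ h k B : ℝ) < θ.nPlus B) := by
  induction k with
  | zero =>
    refine ⟨?_, fun k' hk' => absurd hk' (Nat.not_lt_zero _), fun B => Or.inl (by simp [n, visits])⟩
    intro B hB
    simp only [partition, Finset.mem_singleton] at hB
    subst hB
    exact ⟨root_mem_nodes θ, fun i hi => absurd hi (Nat.not_lt_zero _),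
      Or.inl (by simp [n, visits])⟩
  | succ k ih =>
    obtain ⟨ih1, ih2, ih3⟩ := ih (by omega)
    have hb := hsel k (by omega)
    set b := τ.ball (k + 1) h with hbdef
    obtain ⟨hb1, hb2, hb3⟩ := ih1 b hb
    have hkk : k ≤ k + 1 := Nat.le_succ k
    have hne : ∀ B, B ≠ b → n τ h (k + 1) B = n τ h k B := fun B hB => by
      rw [n_succ, if_neg (by rw [← hbdef]; exact fun e => hB e.symm), add_zero]
    have hbn : n τ h (k + 1) b = n τ h k b + 1 := by rw [n_succ, if_pos hbdef.symm]
    refine ⟨?_, ?_, ?_⟩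
    · have hold : ∀ B ∈ θ.partition τ h k, B ≠ b → B ∈ θ.nodes B.lvl ∧
          (∀ i < B.lvl, HasSplit θ τ h (k + 1) (θ.anc B i)) ∧
          (n τ h (k + 1) B = 0 ∨ (n τ h (k + 1) B : ℝ) + 1 < θ.nPlus B) := by
        intro B hB hBb
        obtain ⟨h1, h2, h3⟩ := ih1 B hB
        exact ⟨h1, fun i hi => (h2 i hi).mono hkk, by rwa [hne B hBb]⟩
      intro B hB
      rw [partition] at hB
      split_ifs at hB with hs
      · rw [← hbdef] at hs hB
        rcases Finset.mem_union.1 hB with hB | hB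
        · obtain ⟨hBb, hB⟩ := Finset.mem_erase.1 hB
          exact hold B hB hBb
        · obtain ⟨hBn, hsub⟩ := Finset.mem_filter.1 hB
          have hl := (mem_nodes.1 hBn).1
          have hBb : B ≠ b := fun e => by rw [e] at hl; omega
          have hanc : ∀ i ≤ b.lvl, θ.anc B i = θ.anc b i := fun i hi =>
            anc_anc hBn hb1 hsub hi (Nat.le_succ _)
          refine ⟨hl ▸ hBn, fun i hi => ?_, Or.inl ?_⟩
          · rw [hanc i (by omega)]
            rcases (show i < b.lvl ∨ i = b.lvl by omega) with hi' | hi'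
            · exact (hb2 i hi').mono hkk
            · rw [hi', anc_self hb1]
              exact ⟨by omega, hs⟩
          -- A new child has no plays: an earlier play would force its parent `b` to have split by
          -- then (`ih2`), whereas `b`, still in the partition, is unplayed or below its threshold.
          · rw [hne B hBb]
            by_contra h0
            have hpos : 0 < (visits τ h k B).card := Nat.pos_of_ne_zero h0
            obtain ⟨k', hk'⟩ := Finset.card_pos.1 hpos
            simp only [visits, Finset.mem_filter, Finset.mem_Icc] at hk'
            obtain ⟨⟨h1, h2⟩, h3⟩ := hk'
            obtain ⟨k'', rfl⟩ : ∃ k'', k' = k'' + 1 := ⟨k' - 1, by omega⟩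
            have := ih2 k'' (by omega) b.lvl (by rw [h3]; omega)
            rw [h3, hanc _ le_rfl, anc_self hb1] at this
            rcases hb3 with hb3 | hb3
            · have := this.1; omega
            · have := this.2; linarith
      · by_cases hBb : B = b
        · subst hBb
          exact ⟨hb1, fun i hi => (hb2 i hi).mono hkk, Or.inr (not_le.1 hs)⟩
        · exact hold B hB hBb
    · intro k' hk' i hi
      rcases (show k' < k ∨ k' = k by omega) with hlt | rfl
      · exact (ih2 k' hlt i hi).mono hkk
      · exact (hb2 i hi).mono hkk
    · intro B
      by_cases hBb : B = b
      · subst hBb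
        rw [hbn]
        rcases hb3 with h3 | h3
        · left; omega
        · right; push_cast; exact h3
      · rw [hne B hBb]; exact ih3 B

end Input

end AdaMB

/-! ### Geometric growth of visit counts along the ancestors. -/

namespace AdaMB

open scoped Classical

theorem two_mul_sum_le_of_three_mul_le {ν : ℕ → ℝ} {ℓ : ℕ} (h0 : ∀ i, 0 ≤ ν i)
    (h : ∀ i < ℓ, 3 * ν i ≤ ν (i + 1)) : 2 * ∑ i ∈ Finset.range ℓ, ν i ≤ ν ℓ := by
  induction ℓ with
  | zero => simpa using h0 0
  | succ ℓ ih =>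
    rw [Finset.sum_range_succ]
    have := ih (fun i hi => h i (by omega))
    have := h ℓ (by omega)
    linarith

/-- Under threefold growth each term dominates twice the sum of all earlier ones, which is what
halving the factor at each level requires. Growth is not assumed into the last index: `B` itself
need not have split and may have few plays. -/
theorem sum_mul_pow_le {ν : ℕ → ℝ} {ℓ : ℕ} (h0 : ∀ i, 0 ≤ ν i)
    (h : ∀ i, i + 1 < ℓ → 3 * ν i ≤ ν (i + 1)) :
    ∑ i ∈ Finset.range (ℓ + 1), ν i * (1 / 2) ^ i ≤
      4 * (1 / 2) ^ ℓ * ∑ i ∈ Finset.range (ℓ + 1), ν i := by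
  have key : ∀ m ≤ ℓ, ∑ i ∈ Finset.range m, ν i * (1 / 2) ^ i ≤
      4 * (1 / 2) ^ m * ∑ i ∈ Finset.range m, ν i := by
    intro m hm
    induction m with
    | zero => simp
    | succ m ih =>
      have h1 := ih (by omega)
      have h2 := two_mul_sum_le_of_three_mul_le (ℓ := m) h0 (fun i hi => h i (by omega))
      rw [Finset.sum_range_succ, Finset.sum_range_succ, pow_succ]
      have h3 : (0 : ℝ) < (1 / 2) ^ m := by positivity
      nlinarith
  rw [Finset.sum_range_succ, Finset.sum_range_succ]
  have h3 : (0 : ℝ) < (1 / 2) ^ ℓ := by positivity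
  nlinarith [key ℓ le_rfl, mul_nonneg h3.le (h0 ℓ)]

theorem sum_sqrt_le {ν : ℕ → ℝ} {ℓ : ℕ} (h0 : ∀ i, 0 ≤ ν i)
    (h : ∀ i, i + 1 < ℓ → 3 * ν i ≤ ν (i + 1)) :
    ∑ i ∈ Finset.range (ℓ + 1), √(ν i) ≤ 2.6 * √(∑ i ∈ Finset.range (ℓ + 1), ν i) := by
  have key : ∀ m < ℓ, ∑ i ∈ Finset.range (m + 1), √(ν i) ≤ 2.4 * √(ν m) := by
    intro m hm
    induction m with
    | zero => simp; linarith [Real.sqrt_nonneg (ν 0)]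
    | succ m ih =>
      rw [Finset.sum_range_succ]
      have h1 := ih (by omega)
      -- `1/√3 < 0.58`, and `2.4 * 0.58 + 1 ≤ 2.4` closes the induction.
      have h2 : √(ν m) ≤ 0.58 * √(ν (m + 1)) := by
        refine Real.sqrt_le_left (by positivity) |>.2 ?_ |>.trans le_rfl
        rw [mul_pow, Real.sq_sqrt (h0 _)]
        linarith [h m hm, h0 (m + 1)]
      linarith [Real.sqrt_nonneg (ν (m + 1))]
  rcases ℓ with _ | m
  · simp; linarith [Real.sqrt_nonneg (ν 0)]
  · rw [Finset.sum_range_succ]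
    have h1 := key m (by omega)
    have h2 : ν m + ν (m + 1) ≤ ∑ i ∈ Finset.range (m + 1 + 1), ν i := by
      rw [Finset.sum_range_succ, Finset.sum_range_succ]
      linarith [Finset.sum_nonneg (fun i (_ : i ∈ Finset.range m) => h0 i)]
    -- Cauchy–Schwarz, with `2.4² + 1 = 2.6²`.
    have h3 : 2.4 * √(ν m) + √(ν (m + 1)) ≤ 2.6 * √(ν m + ν (m + 1)) := by
      have e1 := Real.sq_sqrt (h0 m)
      have e2 := Real.sq_sqrt (h0 (m + 1))
      have e3 := Real.sq_sqrt (add_nonneg (h0 m) (h0 (m + 1)))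
      refine abs_le_of_sq_le_sq' (a := 2.4 * √(ν m) + √(ν (m + 1))) ?_ (by positivity) |>.2
      rw [mul_pow, e3]
      nlinarith [sq_nonneg (√(ν m) - 2.4 * √(ν (m + 1)))]
    have h4 := Real.sqrt_le_sqrt h2
    linarith

namespace Input

theorem n_mul_tHat {S A : Type*} (τ : Trajectory S A) (h k : ℕ) (C : Set S) (B : Ball S A) :
    (n τ h k B : ℝ) * tHat τ h k C B =
      ∑ k' ∈ visits τ h k B, if τ.st k' (h + 1) ∈ C then (1 : ℝ) else 0 := by
  rw [tHat, Finset.sum_boole]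
  rcases Nat.eq_zero_or_pos (n τ h k B) with h0 | h0
  · have : visits τ h k B = ∅ := Finset.card_eq_zero.1 h0
    simp [this, h0]
  · have : (n τ h k B : ℝ) ≠ 0 := by positivity
    field_simp

variable {S A : Type*} [MetricSpace S] [MeasurableSpace S] [MetricSpace A] [MeasurableSpace A]

/-- The episodes up to `k` in which a ball containing `B` is selected. -/
noncomputable def allVisits (θ : Input S A) (τ : Trajectory S A) (h k : ℕ) (B : Ball S A) :
    Finset ℕ :=
  (Finset.Icc 1 k).filter (fun k' => τ.ball k' h ∈ θ.ancestors B)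

theorem sum_allVisits_eq_sum_ancestors (θ : Input S A) (τ : Trajectory S A) (h k : ℕ)
    (B : Ball S A) {M : Type*} [AddCommMonoid M] (G : ℕ → M) :
    ∑ k' ∈ θ.allVisits τ h k B, G k' =
      ∑ B' ∈ θ.ancestors B, ∑ k' ∈ visits τ h k B', G k' := by
  rw [← Finset.sum_fiberwise_of_maps_to (s := θ.allVisits τ h k B) (t := θ.ancestors B)
    (g := fun k' => τ.ball k' h) (fun k' hk' => (Finset.mem_filter.1 hk').2)]
  refine Finset.sum_congr rfl fun B' hB' => Finset.sum_congr ?_ fun _ _ => rfl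
  ext k'
  simp only [allVisits, visits, Finset.mem_filter]
  constructor
  · rintro ⟨⟨h1, -⟩, h3⟩; exact ⟨h1, h3⟩
  · rintro ⟨h1, h3⟩; exact ⟨⟨h1, h3 ▸ hB'⟩, h3⟩

theorem card_allVisits (θ : Input S A) (τ : Trajectory S A) (h k : ℕ) (B : Ball S A) :
    (θ.allVisits τ h k B).card = θ.nBar τ h k B := by
  rw [Finset.card_eq_sum_ones, sum_allVisits_eq_sum_ancestors, nBar]
  simp [n]

theorem nBar_le (θ : Input S A) (τ : Trajectory S A) (h k : ℕ) (B : Ball S A) :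
    θ.nBar τ h k B ≤ k := by
  rw [← card_allVisits]
  exact (Finset.card_filter_le _ _).trans (by simp)

theorem nBar_eq_sum {θ : Input S A} (τ : Trajectory S A) (h k : ℕ) {B : Ball S A} {ℓ : ℕ}
    (hB : B ∈ θ.nodes ℓ) :
    θ.nBar τ h k B = ∑ i ∈ Finset.range (ℓ + 1), n τ h k (θ.anc B i) := by
  rw [nBar, sum_ancestors hB]

section Invariants

variable {θ : Input S A} {τ : Trajectory S A} {h K k : ℕ} {B : Ball S A}

theorem mem_nodes_of_mem_partition
    (hsel : ∀ k < K, τ.ball (k + 1) h ∈ θ.partition τ h k) (hk : k ≤ K)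
    (hB : B ∈ θ.partition τ h k) : B ∈ θ.nodes B.lvl :=
  ((partition_invariant θ τ h K hsel k hk).1 B hB).1

/-- The ancestor at level `i + 1` has split, so its count is at least `4 n_+ - 1`, with `n_+` the
threshold at level `i`. A ball at level `i` with more than one play has count below `n_+`, and
integrality gives even a factor `4`; with at most one play, `4 n_+ - 1 ≥ 3` gives the factor `3`. -/
theorem three_mul_n_anc_le (hH : 1 ≤ θ.H)
    (hsel : ∀ k < K, τ.ball (k + 1) h ∈ θ.partition τ h k) (hk : k ≤ K)
    (hB : B ∈ θ.partition τ h k) {i : ℕ} (hi : i + 1 < B.lvl) :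
    3 * (n τ h k (θ.anc B i) : ℝ) ≤ n τ h k (θ.anc B (i + 1)) := by
  obtain ⟨h1, -, h3⟩ := partition_invariant θ τ h K hsel k hk
  obtain ⟨hn, hs, -⟩ := h1 B hB
  have hl : (θ.anc B (i + 1)).lvl = (θ.anc B i).lvl + 1 := by
    rw [anc_lvl hn hi.le, anc_lvl hn (by omega)]
  have h4 := four_mul_nPlus_le θ hH hl
  have h5 := one_le_nPlus θ hH (θ.anc B i)
  have h6 := (hs (i + 1) hi).2
  rcases h3 (θ.anc B i) with h7 | h7
  · have : (n τ h k (θ.anc B i) : ℝ) ≤ 1 := by exact_mod_cast h7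
    linarith
  · have h8 : 4 * n τ h k (θ.anc B i) < n τ h k (θ.anc B (i + 1)) + 1 := by
      have : 4 * (n τ h k (θ.anc B i) : ℝ) < n τ h k (θ.anc B (i + 1)) + 1 := by linarith
      exact_mod_cast this
    exact_mod_cast (by omega : 3 * n τ h k (θ.anc B i) ≤ n τ h k (θ.anc B (i + 1)))

/-- Every strict ancestor was played before splitting. Hence `ℓ(B) ≤ K`, so the scale `ℓ(B)` is
among those covered by the good event. -/
theorem lvl_le_nBar
    (hsel : ∀ k < K, τ.ball (k + 1) h ∈ θ.partition τ h k) (hk : k ≤ K)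
    (hB : B ∈ θ.partition τ h k) : B.lvl ≤ θ.nBar τ h k B := by
  obtain ⟨h1, -, -⟩ := partition_invariant θ τ h K hsel k hk
  obtain ⟨hn, hs, -⟩ := h1 B hB
  rw [nBar_eq_sum τ h k hn, Finset.sum_range_succ]
  have := Finset.card_nsmul_le_sum (Finset.range B.lvl) (fun i => n τ h k (θ.anc B i)) 1
    (fun i hi => (hs i (Finset.mem_range.1 hi)).1)
  simp at this
  omega

theorem one_le_nBar
    (hsel : ∀ k < K, τ.ball (k + 1) h ∈ θ.partition τ h k) (hk1 : 1 ≤ k) (hk : k ≤ K)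
    (hB : B ∈ θ.partition τ h k) : 1 ≤ θ.nBar τ h k B := by
  have hn := mem_nodes_of_mem_partition hsel hk hB
  have h0 : τ.ball (0 + 1) h = root := by
    simpa [partition] using hsel 0 (by omega)
  have h1 : θ.anc B 0 = root :=
    anc_eq hn (Nat.zero_le _) (root_mem_nodes θ) (fun p _ => by simp [root, Ball.carrier])
  rw [nBar_eq_sum τ h k hn, Finset.sum_range_succ', h1]
  have : 1 ≤ n τ h k (root : Ball S A) :=
    Finset.card_pos.2 ⟨1, by simp [visits, hk1]; simpa using h0⟩
  omega

/-- The balls in which the data were collected have average diameter at most `4 D(B)`. This is the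
source of both bias terms, `4 D(B)` and `4 L_T D(B)`. -/
theorem sum_allVisits_pow_le (hH : 1 ≤ θ.H)
    (hsel : ∀ k < K, τ.ball (k + 1) h ∈ θ.partition τ h k) (hk : k ≤ K)
    (hB : B ∈ θ.partition τ h k) :
    ∑ k' ∈ θ.allVisits τ h k B, (1 / 2 : ℝ) ^ (τ.ball k' h).lvl ≤
      4 * (1 / 2) ^ B.lvl * θ.nBar τ h k B := by
  have hn := mem_nodes_of_mem_partition hsel hk hB
  have := sum_mul_pow_le (ν := fun i => (n τ h k (θ.anc B i) : ℝ)) (ℓ := B.lvl)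
    (fun i => Nat.cast_nonneg _) (fun i hi => three_mul_n_anc_le hH hsel hk hB hi)
  rw [nBar_eq_sum τ h k hn, sum_allVisits_eq_sum_ancestors, sum_ancestors hn]
  push_cast
  refine le_trans (Finset.sum_le_sum fun i hi => ?_) this
  rw [Finset.sum_congr rfl (g := fun _ => (1 / 2 : ℝ) ^ i), Finset.sum_const, nsmul_eq_mul, n]
  intro k' hk'
  rw [(Finset.mem_filter.1 hk').2, anc_lvl hn (Nat.lt_succ_iff.1 (Finset.mem_range.1 hi))]

theorem sum_sqrt_n_anc_le (hH : 1 ≤ θ.H)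
    (hsel : ∀ k < K, τ.ball (k + 1) h ∈ θ.partition τ h k) (hk : k ≤ K)
    (hB : B ∈ θ.partition τ h k) :
    ∑ B' ∈ θ.ancestors B, √(n τ h k B' : ℝ) ≤ 2.6 * √(θ.nBar τ h k B : ℝ) := by
  have hn := mem_nodes_of_mem_partition hsel hk hB
  have := sum_sqrt_le (ν := fun i => (n τ h k (θ.anc B i) : ℝ)) (ℓ := B.lvl)
    (fun i => Nat.cast_nonneg _) (fun i hi => three_mul_n_anc_le hH hsel hk hB hi)
  rw [nBar_eq_sum τ h k hn, sum_ancestors hn]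
  push_cast
  exact this

end Invariants

/-! ### The aggregated transition estimate -/

theorem sum_tHat_eq {θ : Input S A} (τ : Trajectory S A) (h k i : ℕ) (C : Set S) (B : Ball S A)
    (w : ℝ) :
    ∑ C' ∈ (θ.partS.cells i).filter (fun C' => C ⊆ C'), w * n τ h k B * tHat τ h k C' B =
      ∑ k' ∈ visits τ h k B,
        if C ⊆ θ.partS.cellOf i (τ.st k' (h + 1)) then w else 0 := by
  simp_rw [mul_assoc, n_mul_tHat, Finset.mul_sum]
  rw [Finset.sum_comm]
  refine Finset.sum_congr rfl fun k' _ => ?_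
  set x := τ.st k' (h + 1)
  have : ∀ C' ∈ (θ.partS.cells i).filter (fun C' => C ⊆ C'),
      w * (if x ∈ C' then (1 : ℝ) else 0) = if θ.partS.cellOf i x = C' then w else 0 := by
    intro C' hC'
    rw [mul_ite, mul_one, mul_zero]
    simp only [θ.partS.mem_iff_cellOf_eq (Finset.mem_filter.1 hC').1]
  rw [Finset.sum_congr rfl this, Finset.sum_ite_eq]
  simp [θ.partS.cellOf_mem]

theorem tBar_nonneg (θ : Input S A) (τ : Trajectory S A) (h k : ℕ) (C : Set S) (B : Ball S A) :
    0 ≤ θ.tBar τ h k C B := by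
  unfold tBar tHat
  positivity

theorem integral_tBarMeasure [BorelSpace S] (θ : Input S A) (τ : Trajectory S A) (h k : ℕ)
    (B : Ball S A) (f : S → ℝ) :
    ∫ x, f x ∂(θ.tBarMeasure τ h k B) =
      ∑ C ∈ θ.partS.cells B.lvl, θ.tBar τ h k C B * f (θ.partS.center C) := by
  rw [tBarMeasure, integral_finsetSum_measure]
  · refine Finset.sum_congr rfl fun C _ => ?_
    rw [integral_smul_measure, integral_dirac, smul_eq_mul,
      ENNReal.toReal_ofReal (θ.tBar_nonneg τ h k C B)]
  · intro C _
    exact (integrable_dirac (by simp)).smul_measure ENNReal.ofReal_ne_top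

/-- An observed state and the centers that receive its mass lie in one cell of level `ℓ(B')`, so
moving the mass changes `f` by at most `2^(-ℓ(B'))`. -/
theorem integral_tBarMeasure_le [BorelSpace S] {θ : Input S A} (τ : Trajectory S A) (h k : ℕ)
    {B : Ball S A} {f : S → ℝ} (hf : LipschitzWith 1 f) :
    ∫ x, f x ∂(θ.tBarMeasure τ h k B) ≤
      (∑ k' ∈ θ.allVisits τ h k B,
        (f (τ.st k' (h + 1)) + (1 / 2) ^ (τ.ball k' h).lvl)) / θ.nBar τ h k B := by
  rw [integral_tBarMeasure]
  simp_rw [tBar, div_mul_eq_mul_div]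
  rw [← Finset.sum_div]
  gcongr
  simp_rw [sum_tHat_eq, Finset.sum_mul]
  rw [Finset.sum_comm, sum_allVisits_eq_sum_ancestors]
  refine Finset.sum_le_sum fun B' hB' => ?_
  rw [Finset.sum_comm]
  refine Finset.sum_le_sum fun k' hk' => ?_
  have hle : B'.lvl ≤ B.lvl := by
    simp only [ancestors, Finset.mem_filter, Finset.mem_biUnion, Finset.mem_range] at hB'
    obtain ⟨⟨i, hi, hB'⟩, -⟩ := hB'
    rw [(mem_nodes.1 hB').1]; omega
  rw [(Finset.mem_filter.1 hk').2]
  set x := τ.st k' (h + 1)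
  set C' := θ.partS.cellOf B'.lvl x with hC'
  have hcard := θ.partS.card_descendants hle (θ.partS.cellOf_mem B'.lvl x)
  -- The weights sum to one because a cell of level `ℓ(B')` has exactly `2^(d_S (ℓ(B) - ℓ(B')))`
  -- descendants at level `ℓ(B)`.
  have hw : (2 : ℝ) ^ (-(θ.dS * ((B.lvl : ℝ) - (B'.lvl : ℝ)))) *
      (((θ.partS.cells B.lvl).filter (fun C => C ⊆ C')).card : ℝ) = 1 := by
    rw [hcard, ← Real.rpow_natCast, ← Real.rpow_mul (by norm_num), Nat.cast_sub hle,
      ← Real.rpow_add (by norm_num)]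
    simp
  simp_rw [ite_mul, zero_mul]
  rw [← Finset.sum_filter]
  calc _ ≤ ∑ C ∈ (θ.partS.cells B.lvl).filter (fun C => C ⊆ C'),
        (2 : ℝ) ^ (-(θ.dS * ((B.lvl : ℝ) - (B'.lvl : ℝ)))) * (f x + (1 / 2) ^ B'.lvl) := by
        refine Finset.sum_le_sum fun C hC => ?_
        obtain ⟨hC, hs⟩ := Finset.mem_filter.1 hC
        have h1 := θ.partS.dist_le_pow (θ.partS.cellOf_mem B'.lvl x)
          (hs (θ.partS.center_mem _ C hC)) (θ.partS.mem_cellOf _ x)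
        have h2 := hf.dist_le_mul (θ.partS.center C) x
        rw [Real.dist_eq, NNReal.coe_one, one_mul] at h2
        have h3 := (abs_le.1 (h2.trans h1)).2
        gcongr
        linarith
    _ = _ := by
        rw [Finset.sum_const, nsmul_eq_mul, ← mul_assoc, mul_comm (Nat.cast _ : ℝ), hw, one_mul]

end Input

end AdaMB

/-! ### Deviation of Lipschitz functions: discretization and chaining. -/

namespace AdaMB

open scoped Classical

/-- The total deviation `∑_k (f(X_k) - ∫ f dM_k)` of the points `X_k` from the laws `M_k`. -/
noncomputable def deviation {X : Type*} [MeasurableSpace X] (V : Finset ℕ) (x : ℕ → X)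
    (M : ℕ → Measure X) (f : X → ℝ) : ℝ :=
  ∑ k ∈ V, (f (x k) - ∫ y, f y ∂(M k))

/-- The deviation on a set. -/
noncomputable def setDeviation {X : Type*} [MeasurableSpace X] (V : Finset ℕ) (x : ℕ → X)
    (M : ℕ → Measure X) (C : Set X) : ℝ :=
  ∑ k ∈ V, (C.indicator 1 (x k) - (M k).real C)

theorem integrable_of_lipschitz {X : Type*} [MetricSpace X] [MeasurableSpace X] [BorelSpace X]
    [CompactSpace X] {f : X → ℝ} (hf : LipschitzWith 1 f) (μ : Measure X) [IsFiniteMeasure μ] :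
    Integrable f μ :=
  hf.continuous.integrable_of_hasCompactSupport (HasCompactSupport.of_compactSpace f)

theorem sqrt_pow_nat {a : ℝ} (ha : 0 ≤ a) (j : ℕ) : √(a ^ j) = √a ^ j := by
  induction j with
  | zero => simp
  | succ j ih => rw [pow_succ, Real.sqrt_mul (by positivity), ih, pow_succ]

namespace DyadicPartition

variable {X : Type*} [MetricSpace X] [MeasurableSpace X] {d : ℝ} (P : DyadicPartition X d)

theorem step_eq_sum (j : ℕ) (a : Set X → ℝ) (x : X) :
    a (P.cellOf j x) = ∑ C ∈ P.cells j, a C * C.indicator 1 x := by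
  rw [Finset.sum_eq_single (P.cellOf j x)]
  · simp [P.mem_cellOf]
  · intro C hC hne
    rw [Set.indicator_of_notMem, mul_zero]
    exact fun hx => hne (P.cellOf_eq hC hx).symm
  · exact fun h => absurd (P.cellOf_mem j x) h

theorem integrable_step (j : ℕ) (a : Set X → ℝ) (μ : Measure X) [IsFiniteMeasure μ] :
    Integrable (fun x => a (P.cellOf j x)) μ := by
  simp_rw [P.step_eq_sum]
  refine integrable_finsetSum _ fun C hC => ?_
  exact ((integrable_const (1 : ℝ)).indicator (P.measurable j C hC)).const_mul _

theorem integral_step (j : ℕ) (a : Set X → ℝ) (μ : Measure X) [IsFiniteMeasure μ] :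
    ∫ x, a (P.cellOf j x) ∂μ = ∑ C ∈ P.cells j, a C * μ.real C := by
  simp_rw [P.step_eq_sum]
  rw [integral_finsetSum]
  · refine Finset.sum_congr rfl fun C hC => ?_
    rw [integral_const_mul, integral_indicator_one (P.measurable j C hC)]
  · intro C hC
    exact ((integrable_const (1 : ℝ)).indicator (P.measurable j C hC)).const_mul _

variable (V : Finset ℕ) (x : ℕ → X) (M : ℕ → Measure X)

/-- The total variation `∑_C |dev(C)|` of the deviation on the cells of level `j`. -/
noncomputable def variation (j : ℕ) : ℝ := ∑ C ∈ P.cells j, |setDeviation V x M C|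

variable [∀ k, IsProbabilityMeasure (M k)]

theorem deviation_step (j : ℕ) (a : Set X → ℝ) :
    deviation V x M (fun y => a (P.cellOf j y)) =
      ∑ C ∈ P.cells j, a C * setDeviation V x M C := by
  simp_rw [deviation, setDeviation, P.integral_step, Finset.mul_sum]
  rw [Finset.sum_comm]
  refine Finset.sum_congr rfl fun k _ => ?_
  rw [P.step_eq_sum j a, ← Finset.sum_sub_distrib]
  exact Finset.sum_congr rfl fun C _ => by ring

theorem sum_setDeviation (j : ℕ) : ∑ C ∈ P.cells j, setDeviation V x M C = 0 := by
  have := P.deviation_step V x M j (fun _ => 1)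
  simpa [deviation] using this.symm

theorem setDeviation_biUnion (j : ℕ) {T : Finset (Set X)} (hT : T ⊆ P.cells j) :
    setDeviation V x M (⋃ C ∈ T, C) = ∑ C ∈ T, setDeviation V x M C := by
  have hmem : ∀ y, P.cellOf j y ∈ T ↔ y ∈ ⋃ C ∈ T, C := by
    intro y
    simp only [Set.mem_iUnion, exists_prop]
    exact ⟨fun h => ⟨_, h, P.mem_cellOf j y⟩,
      fun ⟨C, hC, hy⟩ => by rwa [P.cellOf_eq (hT hC) hy]⟩
  have hfun : (fun y => (fun C => if C ∈ T then (1 : ℝ) else 0) (P.cellOf j y)) =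
      (⋃ C ∈ T, C).indicator 1 := by
    ext y
    simp only [hmem, Set.indicator_apply, Pi.one_apply]
  have hm : MeasurableSet (⋃ C ∈ T, C) :=
    T.measurableSet_biUnion fun C hC => P.measurable j C (hT hC)
  have h1 := P.deviation_step V x M j (fun C => if C ∈ T then (1 : ℝ) else 0)
  rw [hfun] at h1
  simp only [deviation, integral_indicator_one hm, ite_mul, one_mul, zero_mul] at h1
  rw [setDeviation, h1, ← Finset.sum_filter, Finset.filter_mem_eq_inter,
    Finset.inter_eq_right.2 hT]

/-- Deviations of all cells sum to zero, so their absolute values sum to twice the positive part,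
which is the deviation on one union of cells. Concentration is thus needed only for unions. -/
theorem variation_le (j : ℕ) {r : ℝ}
    (hr : ∀ T ⊆ P.cells j, setDeviation V x M (⋃ C ∈ T, C) ≤ r) :
    P.variation V x M j ≤ 2 * r := by
  have h0 := P.sum_setDeviation V x M j
  have h1 := hr _ (Finset.filter_subset (fun C => 0 ≤ setDeviation V x M C) (P.cells j))
  rw [P.setDeviation_biUnion V x M j (Finset.filter_subset _ _), Finset.sum_filter] at h1
  have : P.variation V x M j =
      ∑ C ∈ P.cells j, (2 * (if 0 ≤ setDeviation V x M C then setDeviation V x M C else 0)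
        - setDeviation V x M C) := by
    refine Finset.sum_congr rfl fun C _ => ?_
    split_ifs with h
    · rw [abs_of_nonneg h]; ring
    · rw [abs_of_neg (not_le.1 h)]; ring
  rw [this, Finset.sum_sub_distrib, h0, ← Finset.mul_sum]
  linarith

section Chaining

variable {f : X → ℝ}

theorem abs_sub_center_le (hf : LipschitzWith 1 f) (j : ℕ) (y : X) :
    |f y - f (P.center (P.cellOf j y))| ≤ (1 / 2) ^ j := by
  have h := hf.dist_le_mul y (P.center (P.cellOf j y))
  rw [Real.dist_eq, NNReal.coe_one, one_mul] at h
  exact h.trans (P.dist_center_le j y)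

theorem deviation_le_step [BorelSpace X] [CompactSpace X] (hf : LipschitzWith 1 f) (J : ℕ) :
    deviation V x M f ≤ deviation V x M (fun y => f (P.center (P.cellOf J y))) +
      2 * (1 / 2) ^ J * V.card := by
  have : (2 * (1 / 2) ^ J * V.card : ℝ) = ∑ k ∈ V, 2 * (1 / 2) ^ J := by
    rw [Finset.sum_const, nsmul_eq_mul, mul_comm]
  rw [this, deviation, deviation, ← Finset.sum_add_distrib]
  refine Finset.sum_le_sum fun k _ => ?_
  have h1 := (abs_le.1 (P.abs_sub_center_le hf J (x k))).2
  have h2 : ∫ y, f (P.center (P.cellOf J y)) ∂(M k) ≤ ∫ y, (f y + (1 / 2) ^ J) ∂(M k) := by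
    refine integral_mono (P.integrable_step J (fun C => f (P.center C)) (M k))
      ((integrable_of_lipschitz hf (M k)).add (integrable_const _)) fun y => ?_
    have := (abs_le.1 (P.abs_sub_center_le hf J y)).1
    dsimp only
    linarith
  rw [integral_add (integrable_of_lipschitz hf (M k)) (integrable_const _)] at h2
  simp only [integral_const, probReal_univ, smul_eq_mul, one_mul] at h2
  linarith

/-- Since total deviation is zero, a constant may be subtracted from `f`. The space has diameter at
most `1`, so subtracting the midrange leaves values of size at most `1/2`. -/
theorem deviation_step_base (hf : LipschitzWith 1 f) (j : ℕ) :
    deviation V x M (fun y => f (P.center (P.cellOf j y))) ≤ 1 / 2 * P.variation V x M j := by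
  have hd := P.deviation_step V x M j (fun C => f (P.center C))
  rw [hd]
  rcases (P.cells j).eq_empty_or_nonempty with he | hne
  · simp [variation, he]
  obtain ⟨C₁, h₁, hmax⟩ := (P.cells j).exists_max_image (fun C => f (P.center C)) hne
  obtain ⟨C₂, h₂, hmin⟩ := (P.cells j).exists_min_image (fun C => f (P.center C)) hne
  have hgap : f (P.center C₁) - f (P.center C₂) ≤ 1 := by
    have h := hf.dist_le_mul (P.center C₁) (P.center C₂)
    rw [Real.dist_eq, NNReal.coe_one, one_mul] at h
    exact (abs_le.1 (h.trans (P.dist_le_one _ _))).2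
  set m := (f (P.center C₁) + f (P.center C₂)) / 2
  have : ∑ C ∈ P.cells j, f (P.center C) * setDeviation V x M C =
      ∑ C ∈ P.cells j, (f (P.center C) - m) * setDeviation V x M C := by
    simp_rw [sub_mul]
    rw [Finset.sum_sub_distrib, ← Finset.mul_sum, P.sum_setDeviation]
    ring
  rw [this, variation, Finset.mul_sum]
  refine Finset.sum_le_sum fun C hC => ?_
  have ha : |f (P.center C) - m| ≤ 1 / 2 := by
    have := hmax C hC
    have := hmin C hC
    rw [abs_le]
    constructor <;> simp only [m] <;> linarith
  calc _ ≤ |(f (P.center C) - m) * setDeviation V x M C| := le_abs_self _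
    _ = |f (P.center C) - m| * |setDeviation V x M C| := abs_mul _ _
    _ ≤ _ := by gcongr

/-- One chaining link: both step functions are constant on cells of level `j + 1`, and there they
differ by at most `2^(-j)`, as nested cells share a level-`j` cell. -/
theorem deviation_step_succ (hf : LipschitzWith 1 f) (j : ℕ) :
    deviation V x M (fun y => f (P.center (P.cellOf (j + 1) y))) ≤
      deviation V x M (fun y => f (P.center (P.cellOf j y))) +
        (1 / 2) ^ j * P.variation V x M (j + 1) := by
  have hcell : ∀ y, P.cellOf j (P.center (P.cellOf (j + 1) y)) = P.cellOf j y := by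
    intro y
    refine P.cellOf_eq (P.cellOf_mem j y) ?_
    exact P.subset_of_mem (Nat.le_succ j) (P.cellOf_mem (j + 1) y) (P.cellOf_mem j y)
      (P.mem_cellOf _ y) (P.mem_cellOf _ y) (P.center_mem _ _ (P.cellOf_mem (j + 1) y))
  have h1 := P.deviation_step V x M (j + 1) (fun C => f (P.center C))
  have h2 := P.deviation_step V x M (j + 1) (fun C => f (P.center (P.cellOf j (P.center C))))
  simp only [hcell] at h2
  rw [h1, h2, variation, Finset.mul_sum, ← Finset.sum_add_distrib]
  refine Finset.sum_le_sum fun C _ => ?_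
  have h3 := P.abs_sub_center_le hf j (P.center C)
  have : (f (P.center C) - f (P.center (P.cellOf j (P.center C)))) * setDeviation V x M C ≤
      (1 / 2) ^ j * |setDeviation V x M C| := by
    refine (le_abs_self _).trans ?_
    rw [abs_mul]
    gcongr
  linarith

theorem deviation_step_le (hf : LipschitzWith 1 f) (j₀ m : ℕ) :
    deviation V x M (fun y => f (P.center (P.cellOf (j₀ + m) y))) ≤
      1 / 2 * P.variation V x M j₀ +
        ∑ i ∈ Finset.range m, (1 / 2) ^ (j₀ + i) * P.variation V x M (j₀ + i + 1) := by
  induction m with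
  | zero => simpa using P.deviation_step_base V x M hf j₀
  | succ m ih =>
    rw [Finset.sum_range_succ]
    have := P.deviation_step_succ V x M hf (j₀ + m)
    rw [← add_assoc j₀ m 1]
    linarith

theorem deviation_le_card [BorelSpace X] [CompactSpace X] (P : DyadicPartition X d)
    (hf : LipschitzWith 1 f) : deviation V x M f ≤ V.card := by
  have : (V.card : ℝ) = ∑ k ∈ V, 1 := by simp
  rw [this, deviation]
  refine Finset.sum_le_sum fun k _ => ?_
  have h1 : ∫ y, (f (x k) - 1) ∂(M k) ≤ ∫ y, f y ∂(M k) := by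
    refine integral_mono (integrable_const _) (integrable_of_lipschitz hf (M k)) fun y => ?_
    have h := hf.dist_le_mul (x k) y
    rw [Real.dist_eq, NNReal.coe_one, one_mul] at h
    have := (abs_le.1 (h.trans (P.dist_le_one _ _))).2
    dsimp only
    linarith
  simp only [integral_const, probReal_univ, smul_eq_mul, one_mul] at h1
  linarith

/-- Wasserstein deviation bound at a single scale. -/
theorem deviation_le_of_variation [BorelSpace X] [CompactSpace X] (hf : LipschitzWith 1 f) {N b : ℝ}
    (hN : (V.card : ℝ) = N) (J : ℕ) (hQ : P.variation V x M J ≤ b) :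
    deviation V x M f ≤ 2 * (1 / 2) ^ J * N + 1 / 2 * b := by
  have h1 := P.deviation_le_step V x M hf J
  have h2 := P.deviation_step_base V x M hf J
  rw [← hN]
  linarith

/-- Wasserstein deviation bound by chaining over the scales, for dimensions above `2`. -/
theorem deviation_le_chaining [BorelSpace X] [CompactSpace X] (hf : LipschitzWith 1 f) (hd : 2 < d) (hV : 1 ≤ V.card)
    {l : ℝ}
    (hQ : ∀ j ≤ V.card, P.variation V x M j ≤
      5.2 * √V.card * (√l + √(P.cells j).card)) :
    deviation V x M f ≤
      V.card * (4 * √(l / V.card) + 300 * (V.card : ℝ) ^ (-(1 / d))) := by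
  obtain ⟨q, hq1, hq⟩ := P.exists_nat_eq_two_rpow
  -- `2 ^ d` is an integer above `4`. The resulting gap, uniform in `d > 2`, is what makes the
  -- constant universal.
  have hq5 : 5 ≤ q := by
    have : (4 : ℝ) < q := by
      rw [hq]
      calc (4 : ℝ) = 2 ^ (2 : ℝ) := by norm_num
        _ < _ := Real.rpow_lt_rpow_of_exponent_lt (by norm_num) hd
    exact_mod_cast this
  set N := V.card with hNdef
  have hNpos : (0 : ℝ) < N := by exact_mod_cast hV
  -- The finest scale `J` has at most `N` cells, and `2^(-(J+1)) ≤ N^(-1/d)`.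
  set J := Nat.log q N with hJ
  have hJ1 : q ^ J ≤ N := Nat.pow_log_le_self q (by omega)
  have hJ2 : N < q ^ (J + 1) := Nat.lt_pow_succ_log_self (by omega) N
  have hJN : J ≤ N := (Nat.lt_pow_self (by omega)).le.trans hJ1
  clear_value J
  have hrate : (1 / 2 : ℝ) ^ (J + 1) ≤ (N : ℝ) ^ (-(1 / d)) := by
    have h1 : (N : ℝ) ≤ ((2 : ℝ) ^ (J + 1)) ^ d := by
      rw [← Real.rpow_natCast, ← Real.rpow_mul (by norm_num), mul_comm, Real.rpow_mul (by norm_num),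
        ← hq, Real.rpow_natCast]
      exact_mod_cast hJ2.le
    have h2 : (N : ℝ) ^ (1 / d) ≤ (2 : ℝ) ^ (J + 1) := by
      calc (N : ℝ) ^ (1 / d) ≤ (((2 : ℝ) ^ (J + 1)) ^ d) ^ (1 / d) := by gcongr
        _ = _ := by
          rw [← Real.rpow_mul (by positivity), mul_one_div_cancel (by linarith), Real.rpow_one]
    rw [Real.rpow_neg hNpos.le, one_div, inv_pow]
    exact inv_anti₀ (by positivity) h2
  have hsq : (N : ℝ) * √(l / N) = √N * √l := by
    rw [Real.sqrt_div' _ hNpos.le]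
    have := Real.mul_self_sqrt hNpos.le
    have h0 : √(N : ℝ) ≠ 0 := by positivity
    field_simp
    rw [sq, this, mul_comm]
  -- Chaining starts at level `3`, the first start for which the coefficient `5.2 (1/2 + ∑_{i ≥ 3}
  -- 2^(-i)) = 3.9` of `√(N l)` stays below `4`. For `J < 3` the trivial bound suffices, since `300
  -- / 8 ≥ 1`.
  rcases Nat.lt_or_ge J 3 with hlt | hge
  · have h1 := deviation_le_card V x M P hf
    have h2 : (1 / 8 : ℝ) ≤ (N : ℝ) ^ (-(1 / d)) := by
      refine le_trans ?_ hrate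
      calc (1 / 8 : ℝ) = (1 / 2) ^ 3 := by norm_num
        _ ≤ _ := pow_le_pow_of_le_one (by norm_num) (by norm_num) (by omega)
    have h3 := Real.sqrt_nonneg (l / N)
    have : (N : ℝ) * 1 ≤ N * (4 * √(l / N) + 300 * (N : ℝ) ^ (-(1 / d))) := by
      gcongr
      linarith
    linarith
  obtain ⟨m, hm⟩ : ∃ m, J = 3 + m := ⟨J - 3, by omega⟩
  have hcard : ∀ j, √((P.cells j).card : ℝ) = √(q : ℝ) ^ j := by
    intro j
    rw [P.card_cells, ← hq, sqrt_pow_nat (Nat.cast_nonneg q)]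
  -- `r` is the growth rate per level of `2^(-j) √#cells`, so the finest scale dominates the sum.
  -- Here `√5 ≥ 2.2`.
  obtain ⟨r, hr1, hq2⟩ : ∃ r : ℝ, 1.1 ≤ r ∧ √(q : ℝ) = 2 * r := by
    refine ⟨√(q : ℝ) / 2, ?_, by ring⟩
    have : (2.2 : ℝ) ≤ √(q : ℝ) := by
      apply Real.le_sqrt_of_sq_le
      have : (5 : ℝ) ≤ q := by exact_mod_cast hq5
      norm_num
      linarith
    linarith
  have hr0 : 0 < r := by linarith
  have hsum : ∀ m' ≤ m, 1 / 2 * P.variation V x M 3 +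
        ∑ i ∈ Finset.range m', (1 / 2) ^ (3 + i) * P.variation V x M (3 + i + 1) ≤
      5.2 * √N * (√l * (3 / 4 - (1 / 2) ^ (2 + m')) + 26 * r ^ (3 + m')) := by
    intro m' hm'
    induction m' with
    | zero =>
      have h1 := hQ 3 (by omega)
      rw [hcard, hq2] at h1
      simp only [Finset.range_zero, Finset.sum_empty, add_zero]
      have h2 : 0 ≤ √(N : ℝ) * r ^ 3 := by positivity
      norm_num at h1 ⊢
      nlinarith
    | succ m' ih =>
      rw [Finset.sum_range_succ]
      have h1 := ih (by omega)
      have h2 := hQ (3 + m' + 1) (by omega)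
      rw [hcard, hq2] at h2
      have h3 : (1 / 2 : ℝ) ^ (3 + m') * P.variation V x M (3 + m' + 1) ≤
          (1 / 2 : ℝ) ^ (3 + m') * (5.2 * √N * (√l + (2 * r) ^ (3 + m' + 1))) := by gcongr
      have h4 : (1 / 2 : ℝ) ^ (3 + m') * (2 * r) ^ (3 + m' + 1) = 2 * r ^ (3 + m' + 1) := by
        rw [mul_pow, ← mul_assoc, pow_succ 2, ← mul_assoc, ← mul_pow]
        norm_num
      have h5 : (1 / 2 : ℝ) ^ (2 + m') = 2 * (1 / 2) ^ (3 + m') := by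
        rw [show 3 + m' = 2 + m' + 1 by ring, pow_succ]; ring
      -- Amounts to `26 ≤ 24 r`, which holds as `r ≥ 1.1`.
      have h6 : 26 * r ^ (3 + m') + 2 * r ^ (3 + m' + 1) ≤ 26 * r ^ (3 + m' + 1) := by
        rw [pow_succ r]
        have : 0 < r ^ (3 + m') := by positivity
        nlinarith
      have h7 : 5.2 * √(N : ℝ) * (26 * r ^ (3 + m') + 2 * r ^ (3 + m' + 1)) ≤
          5.2 * √(N : ℝ) * (26 * r ^ (3 + m' + 1)) := by gcongr
      have h8 : (1 / 2 : ℝ) ^ (3 + m') * (5.2 * √N * (√l + (2 * r) ^ (3 + m' + 1))) =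
          5.2 * √N * (√l * (1 / 2 : ℝ) ^ (3 + m') + 2 * r ^ (3 + m' + 1)) := by
        rw [← h4]; ring
      rw [show 2 + (m' + 1) = 3 + m' by ring, show 3 + (m' + 1) = 3 + m' + 1 by ring]
      rw [h8] at h3
      rw [h5] at h1
      nlinarith
  have h1 := P.deviation_le_step V x M hf J
  have h2 := P.deviation_step_le V x M hf 3 m
  have h3 := hsum m le_rfl
  rw [← hm] at h2 h3
  have hrJ : √(N : ℝ) * r ^ J ≤ N * (1 / 2) ^ J := by
    have : √(q : ℝ) ^ J ≤ √N := by
      rw [← sqrt_pow_nat (Nat.cast_nonneg q)]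
      apply Real.sqrt_le_sqrt
      exact_mod_cast hJ1
    have hr : r = √(q : ℝ) * (1 / 2) := by rw [hq2]; ring
    rw [hr, mul_pow, ← mul_assoc]
    clear hr hq2
    have h4 := Real.mul_self_sqrt hNpos.le
    have : √(N : ℝ) * √(q : ℝ) ^ J ≤ N := by
      calc _ ≤ √(N : ℝ) * √N := by gcongr
        _ = _ := h4
    gcongr
  have h6 : 5.2 * √(N : ℝ) * (√l * (3 / 4 - (1 / 2) ^ (2 + m)) + 26 * r ^ J) ≤
      3.9 * (√N * √l) + 135.2 * (√N * r ^ J) := by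
    have : 0 ≤ √(N : ℝ) * √l * (1 / 2) ^ (2 + m) := by positivity
    nlinarith
  have h7 : (1 / 2 : ℝ) ^ J ≤ 2 * (N : ℝ) ^ (-(1 / d)) := by
    rw [pow_succ] at hrate; linarith
  have h8 : (N : ℝ) * (1 / 2) ^ J ≤ N * (2 * (N : ℝ) ^ (-(1 / d))) := by gcongr
  have h9 : 0 ≤ √(N : ℝ) * √l := by positivity
  have h10 : 0 ≤ (N : ℝ) * (N : ℝ) ^ (-(1 / d)) := by positivity
  -- The constants close because `3.9 ≤ 4` and `2 (2 + 5.2 * 26) = 274.4 ≤ 300`.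
  rw [mul_add, mul_left_comm, hsq]
  linarith

end Chaining

end DyadicPartition

end AdaMB

namespace AdaMB

open scoped Classical

/-! ### A Hoeffding inequality for adaptively selected events -/

/-- Hoeffding's lemma for the law `p δ₁ + (1 - p) δ₀`. -/
theorem bernoulli_mgf_le {p : ℝ} (h0 : 0 ≤ p) (h1 : p ≤ 1) (t : ℝ) :
    Real.exp (-t * p) * (1 + p * (Real.exp t - 1)) ≤ Real.exp (t ^ 2 / 8) := by
  set ν : Measure ℝ := ENNReal.ofReal p • Measure.dirac 1 + ENNReal.ofReal (1 - p) • Measure.dirac 0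
    with hν
  have hint : ∀ f : ℝ → ℝ, ∫ x, f x ∂ν = p * f 1 + (1 - p) * f 0 := by
    intro f
    rw [hν, integral_add_measure, integral_smul_measure, integral_smul_measure, integral_dirac,
      integral_dirac, ENNReal.toReal_ofReal h0, ENNReal.toReal_ofReal (by linarith)]
    · rfl
    · exact (integrable_dirac (by simp)).smul_measure ENNReal.ofReal_ne_top
    · exact (integrable_dirac (by simp)).smul_measure ENNReal.ofReal_ne_top
  have : IsProbabilityMeasure ν := by
    refine ⟨?_⟩
    simp [hν, ← ENNReal.ofReal_add h0 (sub_nonneg.2 h1)]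
  have hb : ∀ᵐ x ∂ν, (fun x : ℝ => x) x ∈ Set.Icc (0 : ℝ) 1 := by
    rw [hν, ae_add_measure_iff]
    constructor <;> refine Measure.ae_smul_measure ?_ _ <;> rw [ae_dirac_eq] <;> simp
  have h := (hasSubgaussianMGF_of_mem_Icc (μ := ν) aemeasurable_id hb).mgf_le t
  rw [mgf, hint, hint] at h
  have e : ((((‖(1 : ℝ) - 0‖₊ / 2) ^ 2 : NNReal) : ℝ) * t ^ 2 / 2) = t ^ 2 / 8 := by
    norm_num
    ring
  rw [e] at h
  refine le_trans (le_of_eq ?_) h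
  have e1 : t * (1 - (p * 1 + (1 - p) * 0)) = -t * p + t := by ring
  have e2 : t * (0 - (p * 1 + (1 - p) * 0)) = -t * p := by ring
  simp only [id_eq]
  rw [e1, e2, Real.exp_add]
  ring

section Hoeffding

variable {Ω : Type*} {mΩ : MeasurableSpace Ω} {μ : Measure Ω} [IsProbabilityMeasure μ]

theorem integral_mul_indicator_of_condExp {m : MeasurableSpace Ω} (hm : m ≤ mΩ) {G p : Ω → ℝ}
    {Y : Set Ω} (hY : MeasurableSet[mΩ] Y) (hG : StronglyMeasurable[m] G) {c : ℝ}
    (hGb : ∀ ω, |G ω| ≤ c) (hp : μ⟦Y | m⟧ =ᵐ[μ] p) :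
    ∫ ω, G ω * Y.indicator 1 ω ∂μ = ∫ ω, G ω * p ω ∂μ := by
  have hYi : Integrable (Y.indicator fun _ => (1 : ℝ)) μ :=
    (integrable_const (1 : ℝ)).indicator hY
  have hGY : Integrable (G * Y.indicator fun _ => (1 : ℝ)) μ :=
    hYi.bdd_mul (c := c) (hG.mono hm).aestronglyMeasurable (ae_of_all _ hGb)
  have h1 := condExp_mul_of_stronglyMeasurable_left (μ := μ) hG hGY hYi
  calc ∫ ω, G ω * Y.indicator 1 ω ∂μ = ∫ ω, (G * Y.indicator fun _ => (1 : ℝ)) ω ∂μ := rfl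
    _ = ∫ ω, (μ[G * Y.indicator fun _ => (1 : ℝ) | m]) ω ∂μ := (integral_condExp hm).symm
    _ = ∫ ω, G ω * p ω ∂μ := by
      refine integral_congr_ae ?_
      filter_upwards [h1, hp] with ω h1 h2
      rw [h1, Pi.mul_apply, h2]

/-- The exponential process of the compensated counts of the events `Y i`, observed on the events
`I i`. -/
noncomputable def expProcess (I Y : ℕ → Set Ω) (p : ℕ → Ω → ℝ) (t : ℝ) (n : ℕ) (ω : Ω) : ℝ :=
  Real.exp (∑ i ∈ Finset.range n,
    (I i).indicator (fun ω => t * ((Y i).indicator 1 ω - p i ω) - t ^ 2 / 8) ω)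

/-- The process is a supermartingale: the compensator `t²/8` is exactly what Hoeffding's lemma
allows for one observed Bernoulli event. Measurability and boundedness are carried along to justify
the conditioning. -/
theorem expProcess_spec {F : ℕ → MeasurableSpace Ω} (hF : ∀ i, F i ≤ mΩ) (hmono : Monotone F)
    {I Y : ℕ → Set Ω} {p : ℕ → Ω → ℝ} (t : ℝ) (n : ℕ)
    (hI : ∀ i < n, MeasurableSet[F i] (I i)) (hY : ∀ i < n, MeasurableSet[F (i + 1)] (Y i))
    (hp : ∀ i < n, StronglyMeasurable[F i] (p i))
    (hp01 : ∀ i < n, ∀ ω, 0 ≤ p i ω ∧ p i ω ≤ 1)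
    (hcond : ∀ i < n, μ⟦Y i | F i⟧ =ᵐ[μ] p i) :
    StronglyMeasurable[F n] (expProcess I Y p t n) ∧
    (∀ ω, expProcess I Y p t n ω ≤ Real.exp (n * |t|)) ∧
    ∫ ω, expProcess I Y p t n ω ∂μ ≤ 1 := by
  induction n with
  | zero =>
    refine ⟨?_, ?_, ?_⟩
    · unfold expProcess; simp only [Finset.range_zero, Finset.sum_empty, Real.exp_zero]
      exact stronglyMeasurable_const
    · intro ω; simp [expProcess]
    · simp [expProcess]
  | succ n ih =>
    obtain ⟨ih1, ih2, ih3⟩ := ih (fun i hi => hI i (by omega)) (fun i hi => hY i (by omega))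
      (fun i hi => hp i (by omega)) (fun i hi => hp01 i (by omega))
      (fun i hi => hcond i (by omega))
    have hle : F n ≤ F (n + 1) := hmono (Nat.le_succ n)
    have hn := Nat.lt_succ_self n
    set Z := expProcess I Y p t n with hZ
    have hZ0 : ∀ ω, 0 ≤ Z ω := fun ω => (Real.exp_pos _).le
    have hsucc : ∀ ω, expProcess I Y p t (n + 1) ω = Z ω * Real.exp ((I n).indicator
        (fun ω => t * ((Y n).indicator 1 ω - p n ω) - t ^ 2 / 8) ω) := by
      intro ω
      rw [hZ, expProcess, expProcess, Finset.sum_range_succ, Real.exp_add]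
    have hY1 : ∀ ω, 0 ≤ (Y n).indicator (1 : Ω → ℝ) ω ∧ (Y n).indicator (1 : Ω → ℝ) ω ≤ 1 := by
      intro ω
      by_cases h : ω ∈ Y n <;> simp [h]
    have hbd : ∀ ω, (I n).indicator
        (fun ω => t * ((Y n).indicator 1 ω - p n ω) - t ^ 2 / 8) ω ≤ |t| := by
      intro ω
      by_cases h : ω ∈ I n
      · rw [Set.indicator_of_mem h]
        have h1 : |(Y n).indicator (1 : Ω → ℝ) ω - p n ω| ≤ 1 := by
          rw [abs_le]
          constructor <;> linarith [(hY1 ω).1, (hY1 ω).2, (hp01 n hn ω).1, (hp01 n hn ω).2]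
        have h2 : t * ((Y n).indicator 1 ω - p n ω) ≤ |t| * 1 := by
          refine (le_abs_self _).trans ?_
          rw [abs_mul]
          gcongr
        nlinarith [sq_nonneg t]
      · rw [Set.indicator_of_notMem h]
        exact abs_nonneg t
    refine ⟨?_, ?_, ?_⟩
    · have : expProcess I Y p t (n + 1) = fun ω => Z ω * Real.exp ((I n).indicator
        (fun ω => t * ((Y n).indicator 1 ω - p n ω) - t ^ 2 / 8) ω) := funext hsucc
      rw [this]
      refine (ih1.mono hle).mul (Real.continuous_exp.comp_stronglyMeasurable ?_)
      refine StronglyMeasurable.indicator ?_ (hle _ (hI n hn))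
      refine StronglyMeasurable.sub (StronglyMeasurable.const_mul ?_ t) stronglyMeasurable_const
      exact (stronglyMeasurable_one.indicator (hY n hn)).sub ((hp n hn).mono hle)
    · intro ω
      rw [hsucc]
      push_cast
      rw [add_mul, one_mul, Real.exp_add]
      exact mul_le_mul (ih2 ω) (Real.exp_le_exp.2 (hbd ω)) (Real.exp_pos _).le (Real.exp_pos _).le
    · set e : Ω → ℝ := fun ω => Real.exp (-t * p n ω) * Real.exp (-(t ^ 2 / 8)) with he
      set a : Ω → ℝ := (I n).indicator (fun ω => e ω - 1) with ha
      set b : Ω → ℝ := (I n).indicator (fun ω => e ω * (Real.exp t - 1)) with hb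
      have heM : StronglyMeasurable[F n] e :=
        (Real.continuous_exp.comp_stronglyMeasurable ((hp n hn).const_mul (-t))).mul
          stronglyMeasurable_const
      have haM : StronglyMeasurable[F n] a :=
        (heM.sub stronglyMeasurable_const).indicator (hI n hn)
      have hbM : StronglyMeasurable[F n] b :=
        (heM.mul stronglyMeasurable_const).indicator (hI n hn)
      have he0 : ∀ ω, 0 ≤ e ω := fun ω => by positivity
      have heb : ∀ ω, e ω ≤ Real.exp |t| := by
        intro ω
        rw [he]
        dsimp only
        rw [← Real.exp_add]
        apply Real.exp_le_exp.2
        have : -t * p n ω ≤ |t| * 1 := by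
          refine (le_abs_self _).trans ?_
          rw [abs_mul, abs_neg, abs_of_nonneg (hp01 n hn ω).1]
          exact mul_le_mul_of_nonneg_left (hp01 n hn ω).2 (abs_nonneg t)
        nlinarith [sq_nonneg t]
      have hab : ∀ ω, |a ω| ≤ Real.exp |t| + 1 := by
        intro ω
        rw [ha, Set.indicator_apply]
        split_ifs
        · rw [abs_le]; constructor <;> linarith [he0 ω, heb ω]
        · rw [abs_zero]; positivity
      have hbb : ∀ ω, |b ω| ≤ Real.exp |t| * |Real.exp t - 1| := by
        intro ω
        rw [hb, Set.indicator_apply]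
        split_ifs
        · rw [abs_mul, abs_of_nonneg (he0 ω)]
          exact mul_le_mul_of_nonneg_right (heb ω) (abs_nonneg _)
        · rw [abs_zero]; positivity
      -- An exponential of an indicator is affine in it, so the increment needs only the conditional
      -- probability of `Y n`; `a` and `b` are `F n`-measurable.
      have hstep : ∀ ω, expProcess I Y p t (n + 1) ω =
          Z ω + Z ω * a ω + Z ω * b ω * (Y n).indicator 1 ω := by
        intro ω
        rw [hsucc]
        by_cases h : ω ∈ I n
        · simp only [ha, hb, Set.indicator_of_mem h]
          have : Real.exp (t * ((Y n).indicator 1 ω - p n ω) - t ^ 2 / 8) =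
              e ω * Real.exp (t * (Y n).indicator 1 ω) := by
            rw [he]
            dsimp only
            rw [← Real.exp_add, ← Real.exp_add]
            congr 1
            ring
          rw [this]
          by_cases hy : ω ∈ Y n <;> simp [hy] <;> ring
        · simp [ha, hb, h]
      have hZi : Integrable Z μ :=
        Integrable.of_bound (ih1.mono (hF n)).aestronglyMeasurable (Real.exp (n * |t|))
          (ae_of_all _ fun ω => by rw [Real.norm_eq_abs, abs_of_nonneg (hZ0 ω)]; exact ih2 ω)
      have hZa : Integrable (fun ω => Z ω * a ω) μ :=
        hZi.mul_bdd (c := Real.exp |t| + 1) (haM.mono (hF n)).aestronglyMeasurable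
          (ae_of_all _ hab)
      have hZb : Integrable (fun ω => Z ω * b ω) μ :=
        hZi.mul_bdd (c := Real.exp |t| * |Real.exp t - 1|) (hbM.mono (hF n)).aestronglyMeasurable
          (ae_of_all _ hbb)
      have hZbY : Integrable (fun ω => Z ω * b ω * (Y n).indicator 1 ω) μ := by
        refine hZb.mul_bdd (c := 1)
          (stronglyMeasurable_one.indicator (hF _ _ (hY n hn))).aestronglyMeasurable
          (ae_of_all _ fun ω => ?_)
        rw [Real.norm_eq_abs, abs_of_nonneg (hY1 ω).1]
        exact (hY1 ω).2
      have hZbp : Integrable (fun ω => Z ω * b ω * p n ω) μ := by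
        refine hZb.mul_bdd (c := 1) ((hp n hn).mono (hF n)).aestronglyMeasurable
          (ae_of_all _ fun ω => ?_)
        rw [Real.norm_eq_abs, abs_of_nonneg (hp01 n hn ω).1]
        exact (hp01 n hn ω).2
      have hpull : ∫ ω, Z ω * b ω * (Y n).indicator 1 ω ∂μ = ∫ ω, Z ω * b ω * p n ω ∂μ := by
        refine integral_mul_indicator_of_condExp (hF n) (hF _ _ (hY n hn)) (ih1.mul hbM)
          (c := Real.exp (n * |t|) * (Real.exp |t| * |Real.exp t - 1|)) (fun ω => ?_) (hcond n hn)
        rw [abs_mul, abs_of_nonneg (hZ0 ω)]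
        exact mul_le_mul (ih2 ω) (hbb ω) (abs_nonneg _) (Real.exp_pos _).le
      simp_rw [hstep]
      have hZZa : Integrable (fun ω => Z ω + Z ω * a ω) μ := hZi.add hZa
      rw [integral_add hZZa hZbY, hpull, ← integral_add hZZa hZbp]
      refine le_trans (integral_mono (hZZa.add hZbp) hZi fun ω => ?_) ih3
      have hkey : 1 + a ω + b ω * p n ω ≤ 1 := by
        by_cases h : ω ∈ I n
        · simp only [ha, hb, Set.indicator_of_mem h]
          have h1 := bernoulli_mgf_le (hp01 n hn ω).1 (hp01 n hn ω).2 t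
          have h2 : e ω * (1 + p n ω * (Real.exp t - 1)) ≤ 1 := by
            rw [he]
            dsimp only
            calc _ = (Real.exp (-t * p n ω) * (1 + p n ω * (Real.exp t - 1))) *
                  Real.exp (-(t ^ 2 / 8)) := by ring
              _ ≤ Real.exp (t ^ 2 / 8) * Real.exp (-(t ^ 2 / 8)) := by gcongr
              _ = 1 := by rw [← Real.exp_add]; simp
          linarith
        · simp [ha, hb, h]
      calc Z ω + Z ω * a ω + Z ω * b ω * p n ω = Z ω * (1 + a ω + b ω * p n ω) := by ring
        _ ≤ Z ω * 1 := mul_le_mul_of_nonneg_left hkey (hZ0 ω)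
        _ = Z ω := mul_one _

/-- Markov's inequality for the exponential process. The random number of observations is fixed at
`m`, since the optimal `t` depends on it; a union bound over `m` follows later. -/
theorem measureReal_adaptive_hoeffding {F : ℕ → MeasurableSpace Ω} (hF : ∀ i, F i ≤ mΩ)
    (hmono : Monotone F) {I Y : ℕ → Set Ω} {p : ℕ → Ω → ℝ} {n : ℕ}
    (hI : ∀ i < n, MeasurableSet[F i] (I i)) (hY : ∀ i < n, MeasurableSet[F (i + 1)] (Y i))
    (hp : ∀ i < n, StronglyMeasurable[F i] (p i))
    (hp01 : ∀ i < n, ∀ ω, 0 ≤ p i ω ∧ p i ω ≤ 1)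
    (hcond : ∀ i < n, μ⟦Y i | F i⟧ =ᵐ[μ] p i) {m : ℕ} (hm : 1 ≤ m) {u : ℝ} (hu : 0 ≤ u) :
    μ.real {ω | ((Finset.range n).filter (fun i => ω ∈ I i)).card = m ∧
      √(m * u / 2) ≤ ∑ i ∈ (Finset.range n).filter (fun i => ω ∈ I i),
        ((Y i).indicator 1 ω - p i ω)} ≤ Real.exp (-u) := by
  have hm0 : (0 : ℝ) < m := by exact_mod_cast hm
  set s := √(m * u / 2) with hs
  have hs0 : 0 ≤ s := Real.sqrt_nonneg _
  have hs2 : s * s = m * u / 2 := Real.mul_self_sqrt (by positivity)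
  -- Maximizes `t s - m t²/8`; the maximum is `2 s²/m = u`.
  set t := 4 * s / m with ht
  have ht0 : 0 ≤ t := by positivity
  obtain ⟨h1, h2, h3⟩ := expProcess_spec (μ := μ) hF hmono t n hI hY hp hp01 hcond
  have hZi : Integrable (expProcess I Y p t n) μ :=
    Integrable.of_bound (h1.mono (hF n)).aestronglyMeasurable (Real.exp (n * |t|))
      (ae_of_all _ fun ω => by
        rw [Real.norm_eq_abs, expProcess, Real.abs_exp]; exact h2 ω)
  have hmarkov := mul_meas_ge_le_integral_of_nonneg
    (ae_of_all μ fun ω => (Real.exp_pos _).le) hZi (Real.exp u)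
  have hsub : {ω | ((Finset.range n).filter (fun i => ω ∈ I i)).card = m ∧
      s ≤ ∑ i ∈ (Finset.range n).filter (fun i => ω ∈ I i),
        ((Y i).indicator 1 ω - p i ω)} ⊆ {ω | Real.exp u ≤ expProcess I Y p t n ω} := by
    rintro ω ⟨hc, hsum⟩
    rw [Set.mem_ofPred_eq, expProcess]
    apply Real.exp_le_exp.2
    simp only [Set.indicator_apply (I _)]
    rw [← Finset.sum_filter, Finset.sum_sub_distrib, ← Finset.mul_sum, Finset.sum_const, hc,
      nsmul_eq_mul]
    have h4 := mul_le_mul_of_nonneg_left hsum ht0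
    have h5 : t * s - m * (t ^ 2 / 8) = u := by
      have : t * s = 2 * u := by
        rw [ht, div_mul_eq_mul_div, mul_assoc, hs2]; field_simp; ring
      have h6 : m * (t ^ 2 / 8) = u := by
        have : m * (t ^ 2 / 8) = 2 * (s * s) / m := by rw [ht]; field_simp; ring
        rw [this, hs2]; field_simp
      linarith
    linarith
  have h4 : Real.exp u * μ.real {ω | Real.exp u ≤ expProcess I Y p t n ω} ≤ 1 :=
    hmarkov.trans h3
  refine (measureReal_mono hsub).trans ?_
  rw [Real.exp_neg, ← one_div, le_div_iff₀ (Real.exp_pos u), mul_comm]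
  exact h4

end Hoeffding

end AdaMB

/-! ### Concentration along the run and the good event. -/

namespace AdaMB

open scoped Classical

namespace Run

variable {Ω S A : Type*} [MeasurableSpace S]

theorem history_mono (ρ : Run Ω S A) (H h : ℕ) : Monotone fun k => ρ.history H k h := by
  intro k l hkl
  refine sup_le_sup (sup_le_sup ?_ ?_) ?_ <;>
  · refine iSup₂_mono fun k' h' => iSup_mono' fun hh => ⟨?_, le_rfl⟩
    obtain ⟨h1, h2, h3, h4⟩ := hh
    refine ⟨h1, h2, h3, ?_⟩
    rcases h4 with h4 | h4
    · left; omega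
    · rcases hkl.lt_or_eq with hlt | heq
      · left; omega
      · right; exact ⟨h4.1.trans heq, h4.2⟩

theorem measurable_X_history (ρ : Run Ω S A) {H k h k' h' : ℕ}
    (hh : 1 ≤ k' ∧ 1 ≤ h' ∧ h' ≤ H + 1 ∧ (k' < k ∨ k' = k ∧ h' ≤ h)) :
    Measurable[ρ.history H k h] (ρ.X k' h') := by
  refine measurable_iff_comap_le.2 ?_
  refine le_trans ?_ (le_sup_left.trans le_sup_left)
  exact le_iSup_of_le k' (le_iSup_of_le h' (le_iSup_of_le hh le_rfl))

theorem measurable_B_history (ρ : Run Ω S A) {H k h k' h' : ℕ}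
    (hh : 1 ≤ k' ∧ 1 ≤ h' ∧ h' ≤ H ∧ (k' < k ∨ k' = k ∧ h' ≤ h)) :
    Measurable[ρ.history H k h] (ρ.B k' h') := by
  refine measurable_iff_comap_le.2 ?_
  refine le_trans ?_ (le_sup_right.trans le_sup_left)
  exact le_iSup_of_le k' (le_iSup_of_le h' (le_iSup_of_le hh le_rfl))

end Run

namespace IsRun

variable {Ω S A : Type*} {mΩ : MeasurableSpace Ω} [MetricSpace S] [MeasurableSpace S]
  [MetricSpace A] [MeasurableSpace A] {θ : Input S A} {M : MDP S A} {μ : Measure Ω}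
  {ρ : Run Ω S A}

theorem history_le (hrun : IsRun θ M μ ρ) (k h : ℕ) : ρ.history θ.H k h ≤ mΩ := by
  refine sup_le (sup_le ?_ ?_) ?_ <;> refine iSup_le fun k' => iSup_le fun h' => iSup_le fun _ => ?_
  · exact measurable_iff_comap_le.1 (hrun.measurable_X k' h')
  · exact measurable_iff_comap_le.1 (hrun.measurable_B k' h')
  · exact measurable_iff_comap_le.1 (hrun.measurable_R k' h')

end IsRun

variable {Ω S A : Type*} [MetricSpace S] [MeasurableSpace S] [MetricSpace A] [MeasurableSpace A]

/-- The balls of the tree. -/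
def Input.tree (θ : Input S A) : Set (Ball S A) := ⋃ ℓ, (θ.nodes ℓ : Set (Ball S A))

/-- Used for measurability: coincidence of two selected balls is a countable union of events once
restricted to the tree. -/
theorem Input.countable_tree (θ : Input S A) : θ.tree.Countable :=
  Set.countable_iUnion fun ℓ => (θ.nodes ℓ).countable_toSet

namespace Run

/-- The episodes from `t` to `k` in which the ball of the tree that is selected in episode `t` is
selected again. -/
noncomputable def revisits (θ : Input S A) (ρ : Run Ω S A) (h t k : ℕ) (ω : Ω) : Finset ℕ :=
  (Finset.Ico t (k + 1)).filter (fun k' => ρ.B k' h ω = ρ.B t h ω ∧ ρ.B t h ω ∈ θ.tree)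

/-- The conditional law of the next state in episode `k`, step `h`. -/
noncomputable def nextLaw (θ : Input S A) (M : MDP S A) (ρ : Run Ω S A) (h : ℕ) (ω : Ω) (k : ℕ) :
    Measure S :=
  M.T h (ρ.X k h ω, θ.action (ρ.B k h ω))

instance (θ : Input S A) (M : MDP S A) (ρ : Run Ω S A) (h : ℕ) (ω : Ω) (k : ℕ) :
    IsProbabilityMeasure (nextLaw θ M ρ h ω k) := by
  have := M.markov_T h
  unfold nextLaw
  infer_instance

end Run

open Run

theorem IsRun.measureReal_revisits_le {mΩ : MeasurableSpace Ω} {μ : Measure Ω}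
    [IsProbabilityMeasure μ] {θ : Input S A} {M : MDP S A} {ρ : Run Ω S A}
    (hrun : IsRun θ M μ ρ) {h t k m : ℕ} (hh : h ∈ Finset.Icc 1 θ.H) (ht : t ∈ Finset.Icc 1 θ.K)
    (hk : k ∈ Finset.Icc 1 θ.K) (hm : 1 ≤ m) {U : Set S} (hU : MeasurableSet U) {u : ℝ}
    (hu : 0 ≤ u) :
    μ.real {ω | (revisits θ ρ h t k ω).card = m ∧
      √(m * u / 2) ≤ setDeviation (revisits θ ρ h t k ω) (fun k' => ρ.X k' (h + 1) ω)
        (nextLaw θ M ρ h ω) U} ≤ Real.exp (-u) := by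
  simp only [Finset.mem_Icc] at hh ht hk
  have := M.markov_T h
  set F : ℕ → MeasurableSpace Ω := fun i => ρ.history θ.H (t + i) h with hF
  have hFle : ∀ i, F i ≤ mΩ := fun i => hrun.history_le _ _
  have hmono : Monotone F := fun i j hij => ρ.history_mono θ.H h (by omega)
  set I : ℕ → Set Ω := fun i => {ω | ρ.B (t + i) h ω = ρ.B t h ω ∧ ρ.B t h ω ∈ θ.tree} with hI
  set Y : ℕ → Set Ω := fun i => ρ.X (t + i) (h + 1) ⁻¹' U with hY
  set p : ℕ → Ω → ℝ := fun i ω => (nextLaw θ M ρ h ω (t + i)).real U with hp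
  have key := measureReal_adaptive_hoeffding (μ := μ) hFle hmono (I := I) (Y := Y) (p := p)
    (n := k + 1 - t) ?_ ?_ ?_ ?_ ?_ hm hu
  · refine le_trans (le_of_eq ?_) key
    congr 1
    ext ω
    have himg : revisits θ ρ h t k ω =
        ((Finset.range (k + 1 - t)).filter (fun i => ω ∈ I i)).image (fun i => t + i) := by
      ext k'
      simp only [revisits, hI, Finset.mem_filter, Finset.mem_Ico, Finset.mem_image,
        Finset.mem_range, Set.mem_ofPred_eq]
      constructor
      · rintro ⟨⟨h1, h2⟩, h3⟩
        exact ⟨k' - t, ⟨by omega, by rwa [Nat.add_sub_cancel' h1]⟩, by omega⟩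
      · rintro ⟨i, ⟨h1, h2⟩, rfl⟩
        exact ⟨⟨by omega, by omega⟩, h2⟩
    have hinj : Function.Injective (fun i => t + i) := add_right_injective t
    have hind : ∀ i, U.indicator (1 : S → ℝ) (ρ.X (t + i) (h + 1) ω) = (Y i).indicator 1 ω :=
      fun i => by simp only [hY, Set.indicator_apply, Set.mem_preimage, Pi.one_apply]
    simp only [Set.mem_ofPred_eq, himg, Finset.card_image_of_injective _ hinj, setDeviation,
      Finset.sum_image hinj.injOn, hind, hp]
    congr!
  · intro i hi
    have : I i = ⋃ b ∈ θ.tree, ((ρ.B (t + i) h ⁻¹' {b}) ∩ (ρ.B t h ⁻¹' {b})) := by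
      ext ω
      simp only [hI, Set.mem_ofPred_eq, Set.mem_iUnion, Set.mem_inter_iff, Set.mem_preimage,
        Set.mem_singleton_iff, exists_prop]
      constructor
      · rintro ⟨h1, h2⟩; exact ⟨_, h2, h1, rfl⟩
      · rintro ⟨b, h1, h2, h3⟩; exact ⟨h2.trans h3.symm, h3 ▸ h1⟩
    rw [this]
    refine @MeasurableSet.biUnion _ _ (F i) _ _ θ.countable_tree fun b _ => ?_
    refine @MeasurableSet.inter _ (F i) _ _ ?_ ?_
    · exact ρ.measurable_B_history ⟨by omega, hh.1, hh.2, Or.inr ⟨rfl, le_rfl⟩⟩ trivial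
    · exact ρ.measurable_B_history ⟨by omega, hh.1, hh.2, by omega⟩ trivial
  -- The next state, at step `h + 1 ≤ H + 1`, is known by step `h` of the following episode.
  · intro i hi
    exact ρ.measurable_X_history ⟨by omega, by omega, by omega, Or.inl (by omega)⟩ hU
  · intro i hi
    have h1 : Measurable[F i] (ρ.X (t + i) h) :=
      ρ.measurable_X_history ⟨by omega, hh.1, by omega, Or.inr ⟨rfl, le_rfl⟩⟩
    have h2 : Measurable[F i] (ρ.B (t + i) h) :=
      ρ.measurable_B_history ⟨by omega, hh.1, hh.2, Or.inr ⟨rfl, le_rfl⟩⟩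
    have h3 : Measurable[F i] (fun ω => θ.action (ρ.B (t + i) h ω)) :=
      (measurable_from_top (f := θ.action)).comp h2
    have h4 : Measurable[F i] (p i) :=
      ((Kernel.measurable_coe (M.T h) hU).ennreal_toReal).comp (h1.prodMk h3)
    exact h4.stronglyMeasurable
  · intro i _ ω
    exact ⟨measureReal_nonneg, measureReal_le_one⟩
  · intro i hi
    exact hrun.transition (t + i) (Finset.mem_Icc.2 ⟨by omega, by omega⟩) h
      (Finset.mem_Icc.2 hh) U hU

theorem log_confidence_nonneg {H K : ℕ} {δ : ℝ} (hH : 1 ≤ H) (hK : 1 ≤ K) (h0 : 0 < δ)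
    (h1 : δ < 1) : 0 ≤ Real.log (H * K ^ 2 / δ) := by
  have hH' : (1 : ℝ) ≤ H := by exact_mod_cast hH
  have hK' : (1 : ℝ) ≤ (K : ℝ) ^ 2 := one_le_pow₀ (by exact_mod_cast hK)
  apply Real.log_nonneg
  rw [le_div_iff₀ h0]
  nlinarith [one_le_mul_of_one_le_of_one_le hH' hK']

theorem exp_neg_two_log {a : ℝ} (ha : 0 < a) : Real.exp (-(2 * Real.log a)) = (a ^ 2)⁻¹ := by
  rw [Real.exp_neg, two_mul, Real.exp_add, Real.exp_log ha, sq]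

/-- Union bound over step `h`, starting episode `t`, final episode `k`, number `m` of revisits,
scale `j` and union `T`. With exponent `2L + #cells` the unions at one scale together cost at most
`e^(-2L) = δ²/(H² K⁴)`, against `H K³ (K + 1)` choices of the other indices. -/
theorem IsRun.exists_event {mΩ : MeasurableSpace Ω} {μ : Measure Ω}
    [IsProbabilityMeasure μ] {θ : Input S A} {M : MDP S A} {ρ : Run Ω S A}
    (hrun : IsRun θ M μ ρ) (hδ0 : 0 < θ.δ) (hδ1 : θ.δ < 1) :
    ∃ E : Set Ω, MeasurableSet E ∧ 1 - 2 * θ.δ ≤ μ.real E ∧ ∀ ω ∈ E,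
      (∀ k ∈ Finset.Icc 1 θ.K, ∀ h ∈ Finset.Icc 1 θ.H, θ.Greedy (ρ.traj ω) h k) ∧
      ∀ h ∈ Finset.Icc 1 θ.H, ∀ t ∈ Finset.Icc 1 θ.K, ∀ k ∈ Finset.Icc 1 θ.K, ∀ j ≤ θ.K,
        ∀ T ⊆ θ.partS.cells j,
          setDeviation (revisits θ ρ h t k ω) (fun k' => ρ.X k' (h + 1) ω)
            (nextLaw θ M ρ h ω) (⋃ C ∈ T, C) ≤
          √((revisits θ ρ h t k ω).card *
            (2 * Real.log (θ.H * θ.K ^ 2 / θ.δ) + (θ.partS.cells j).card) / 2) := by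
  set L := Real.log (θ.H * θ.K ^ 2 / θ.δ) with hL
  set c : ℕ → ℕ := fun j => (θ.partS.cells j).card with hc
  set dev : ℕ → ℕ → ℕ → Finset (Set S) → Ω → ℝ := fun h t k T ω =>
    setDeviation (revisits θ ρ h t k ω) (fun k' => ρ.X k' (h + 1) ω)
            (nextLaw θ M ρ h ω) (⋃ C ∈ T, C) with hdev
  set bad : ℕ × ℕ × ℕ × ℕ × ℕ → Finset (Set S) → Set Ω := fun q T =>
    {ω | (revisits θ ρ q.1 q.2.1 q.2.2.1 ω).card = q.2.2.2.1 ∧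
      √(q.2.2.2.1 * (2 * L + c q.2.2.2.2) / 2) ≤ dev q.1 q.2.1 q.2.2.1 T ω} with hbad
  set s : Finset (ℕ × ℕ × ℕ × ℕ × ℕ) := Finset.Icc 1 θ.H ×ˢ Finset.Icc 1 θ.K ×ˢ Finset.Icc 1 θ.K
    ×ˢ Finset.Icc 1 θ.K ×ˢ Finset.range (θ.K + 1) with hs
  set Bad : Set Ω := ⋃ q ∈ s, ⋃ T ∈ (θ.partS.cells q.2.2.2.2).powerset, bad q T with hBad
  set G : Set Ω := {ω | ¬ ∀ k ∈ Finset.Icc 1 θ.K, ∀ h ∈ Finset.Icc 1 θ.H,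
    θ.Greedy (ρ.traj ω) h k} with hG
  have hG0 : μ.real G = 0 := by
    rw [measureReal_def, show μ G = 0 from hrun.greedy, ENNReal.toReal_zero]
  have hinner : ∀ q ∈ s, μ.real (⋃ T ∈ (θ.partS.cells q.2.2.2.2).powerset, bad q T) ≤
      Real.exp (-(2 * L)) := by
    rintro ⟨h, t, k, m, j⟩ hq
    simp only [hs, Finset.mem_product] at hq
    obtain ⟨hh, ht, hk, hm, hj⟩ := hq
    have hH1 := (Finset.mem_Icc.1 hh)
    have hK1 := (Finset.mem_Icc.1 ht)
    have hL0 : 0 ≤ L := log_confidence_nonneg (by omega) (by omega) hδ0 hδ1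
    have hone : ∀ T ∈ (θ.partS.cells j).powerset, μ.real (bad (h, t, k, m, j) T) ≤
        Real.exp (-(2 * L + c j)) := by
      intro T hT
      refine hrun.measureReal_revisits_le hh ht hk (Finset.mem_Icc.1 hm).1 ?_ (by positivity)
      exact T.measurableSet_biUnion fun C hC =>
        θ.partS.measurable j C (Finset.mem_powerset.1 hT hC)
    refine (measureReal_biUnion_finset_le _ _).trans ((Finset.sum_le_sum hone).trans ?_)
    rw [Finset.sum_const, Finset.card_powerset, nsmul_eq_mul, neg_add, Real.exp_add]
    -- `2^n ≤ e^n`: the exponent `#cells` absorbs the number of unions.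
    have h2 : ((2 ^ (θ.partS.cells j).card : ℕ) : ℝ) * Real.exp (-(c j : ℝ)) ≤ 1 := by
      rw [Real.exp_neg, ← div_eq_mul_inv, div_le_one (Real.exp_pos _)]
      push_cast
      rw [← mul_one ((c j : ℕ) : ℝ), Real.exp_nat_mul]
      have := Real.add_one_le_exp (1 : ℝ)
      exact pow_le_pow_left₀ (by norm_num) (by linarith) _
    have h3 := Real.exp_pos (-(2 * L))
    calc _ = Real.exp (-(2 * L)) *
          (((2 ^ (θ.partS.cells j).card : ℕ) : ℝ) * Real.exp (-(c j : ℝ))) := by ring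
      _ ≤ Real.exp (-(2 * L)) * 1 := by gcongr
      _ = _ := mul_one _
  have hBadle : μ.real Bad ≤ 2 * θ.δ := by
    refine (measureReal_biUnion_finset_le _ _).trans ((Finset.sum_le_sum hinner).trans ?_)
    rw [Finset.sum_const, nsmul_eq_mul]
    have hcard : s.card = θ.H * (θ.K * (θ.K * (θ.K * (θ.K + 1)))) := by simp [hs]
    rw [hcard]
    rcases Nat.eq_zero_or_pos θ.H with hH | hH
    · simp [hH, hδ0.le]
    rcases Nat.eq_zero_or_pos θ.K with hK | hK
    · simp [hK, hδ0.le]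
    have hH' : (1 : ℝ) ≤ θ.H := by exact_mod_cast hH
    have hK' : (1 : ℝ) ≤ θ.K := by exact_mod_cast hK
    rw [exp_neg_two_log (by positivity)]
    push_cast
    have h1 : (θ.H : ℝ) * (θ.K * (θ.K * (θ.K * (θ.K + 1)))) * (((θ.H : ℝ) * θ.K ^ 2 / θ.δ) ^ 2)⁻¹
        = ((θ.K + 1) / θ.K) * (1 / θ.H) * (θ.δ * θ.δ) := by
      field_simp
    rw [h1]
    have h2 : ((θ.K : ℝ) + 1) / θ.K ≤ 2 := by
      rw [div_le_iff₀ (by positivity)]; linarith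
    have h3 : 1 / (θ.H : ℝ) ≤ 1 := by
      rw [div_le_iff₀ (by positivity)]; linarith
    have h4 : θ.δ * θ.δ ≤ θ.δ := by nlinarith
    calc _ ≤ 2 * 1 * θ.δ := by gcongr
      _ = _ := by ring
  have htot : μ.real (toMeasurable μ (G ∪ Bad)) ≤ 2 * θ.δ := by
    rw [measureReal_def, measure_toMeasurable, ← measureReal_def]
    refine (measureReal_union_le _ _).trans ?_
    rw [hG0, zero_add]
    exact hBadle
  refine ⟨(toMeasurable μ (G ∪ Bad))ᶜ, (measurableSet_toMeasurable _ _).compl, ?_, ?_⟩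
  · rw [probReal_compl_eq_one_sub (measurableSet_toMeasurable _ _)]
    linarith
  intro ω hω
  have hω' : ω ∉ G ∪ Bad := fun h => hω (subset_toMeasurable μ _ h)
  rw [Set.mem_union, not_or] at hω'
  refine ⟨not_not.1 hω'.1, ?_⟩
  intro h hh t ht k hk j hj T hT
  by_contra! hlt
  apply hω'.2
  have hmK : (revisits θ ρ h t k ω).card ≤ θ.K := by
    refine (Finset.card_filter_le _ _).trans ?_
    simp only [Nat.card_Ico]
    have := Finset.mem_Icc.1 hk
    have := Finset.mem_Icc.1 ht
    omega
  -- With no revisits both sides of the bound are zero, so a violation needs `m ≥ 1`.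
  have hm1 : 1 ≤ (revisits θ ρ h t k ω).card := by
    rw [Nat.one_le_iff_ne_zero]
    intro h0
    have h1 := Finset.card_eq_zero.1 h0
    simp [h1, setDeviation] at hlt
  simp only [hBad, Set.mem_iUnion]
  refine ⟨(h, t, k, (revisits θ ρ h t k ω).card, j), ?_, T, Finset.mem_powerset.2 hT, rfl, hlt.le⟩
  simp only [hs, Finset.mem_product]
  exact ⟨hh, ht, hk, Finset.mem_Icc.2 ⟨hm1, hmK⟩, Finset.mem_range.2 (by omega)⟩

end AdaMB

/-! ### Assembling the Wasserstein bound. -/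

namespace AdaMB

open scoped Classical

variable {Ω S A : Type*} [MetricSpace S] [MeasurableSpace S] [MetricSpace A] [MeasurableSpace A]

/-- The deviation splits over the ancestors, each contributing `√n(B')` times a common factor;
`sum_sqrt_n_anc_le` sums these to `2.6 √N`, and `variation_le` doubles the constant. -/
theorem variation_allVisits_le {θ : Input S A} {M : MDP S A} {ρ : Run Ω S A} {ω : Ω}
    {h k j : ℕ} {L : ℝ} (hL : 0 ≤ L) (hH : 1 ≤ θ.H)
    (hsel : ∀ k < θ.K, (ρ.traj ω).ball (k + 1) h ∈ θ.partition (ρ.traj ω) h k) (hk : k ≤ θ.K)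
    {B : Ball S A} (hB : B ∈ θ.partition (ρ.traj ω) h k)
    (hdev : ∀ t ∈ Finset.Icc 1 θ.K, ∀ T ⊆ θ.partS.cells j,
      setDeviation (Run.revisits θ ρ h t k ω) (fun k' => ρ.X k' (h + 1) ω)
        (Run.nextLaw θ M ρ h ω) (⋃ C ∈ T, C) ≤
      √((Run.revisits θ ρ h t k ω).card * (2 * L + (θ.partS.cells j).card) / 2)) :
    θ.partS.variation (θ.allVisits (ρ.traj ω) h k B) (fun k' => ρ.X k' (h + 1) ω)
      (Run.nextLaw θ M ρ h ω) j ≤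
    5.2 * √(θ.allVisits (ρ.traj ω) h k B).card * (√L + √(θ.partS.cells j).card) := by
  set τ := ρ.traj ω with hτ
  set c : ℝ := (((θ.partS.cells j).card : ℕ) : ℝ) with hc
  have hc0 : 0 ≤ c := Nat.cast_nonneg _
  have hsq : √((2 * L + c) / 2) ≤ √L + √c := by
    have h1 : √((2 * L + c) / 2) ≤ √(L + c) := Real.sqrt_le_sqrt (by linarith)
    have h2 : √(L + c) ≤ √L + √c := by
      rw [Real.sqrt_le_left (by positivity), add_sq, Real.sq_sqrt hL, Real.sq_sqrt hc0]
      nlinarith [mul_nonneg (Real.sqrt_nonneg L) (Real.sqrt_nonneg c)]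
    exact h1.trans h2
  refine (θ.partS.variation_le _ _ _ j (r := 2.6 * √(θ.nBar τ h k B : ℝ) * √((2 * L + c) / 2))
    fun T hT => ?_).trans ?_
  · rw [setDeviation, Input.sum_allVisits_eq_sum_ancestors]
    have hone : ∀ B' ∈ θ.ancestors B, ∑ k' ∈ Input.visits τ h k B',
        ((⋃ C ∈ T, C).indicator 1 (ρ.X k' (h + 1) ω) -
          (Run.nextLaw θ M ρ h ω k').real (⋃ C ∈ T, C)) ≤
        √(Input.n τ h k B' : ℝ) * √((2 * L + c) / 2) := by
      intro B' hB'
      rcases (Input.visits τ h k B').eq_empty_or_nonempty with he | hne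
      · rw [he, Finset.sum_empty]; positivity
      -- From its first play `t` on, `B'` is the ball selected in episode `t`, so its visits are the
      -- revisits counted from `t`.
      set t := (Input.visits τ h k B').min' hne with ht
      have htm := Finset.min'_mem _ hne
      rw [← ht] at htm
      obtain ⟨ht1, ht2⟩ := Finset.mem_filter.1 htm
      have htI := Finset.mem_Icc.1 ht1
      have htree : B' ∈ θ.tree := by
        simp only [Input.ancestors, Finset.mem_filter, Finset.mem_biUnion] at hB'
        obtain ⟨⟨i, -, hi⟩, -⟩ := hB'
        exact Set.mem_iUnion.2 ⟨i, hi⟩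
      have hvis : Input.visits τ h k B' = Run.revisits θ ρ h t k ω := by
        have ht3 : ρ.B t h ω = B' := ht2
        ext k'
        simp only [Run.revisits, Finset.mem_filter, Finset.mem_Ico, ht3]
        constructor
        · intro hk'
          have h1 := Finset.min'_le _ _ hk'
          rw [← ht] at h1
          obtain ⟨h2, h3⟩ := Finset.mem_filter.1 hk'
          have := Finset.mem_Icc.1 h2
          exact ⟨⟨h1, by omega⟩, h3, htree⟩
        · rintro ⟨⟨h1, h2⟩, h3, -⟩
          exact Finset.mem_filter.2 ⟨Finset.mem_Icc.2 ⟨by omega, by omega⟩, h3⟩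
      have h1 := hdev t (Finset.mem_Icc.2 ⟨htI.1, by omega⟩) T hT
      rw [← hvis, mul_div_assoc, Real.sqrt_mul (Nat.cast_nonneg _)] at h1
      exact h1
    refine (Finset.sum_le_sum hone).trans ?_
    rw [← Finset.sum_mul]
    gcongr
    exact Input.sum_sqrt_n_anc_le hH hsel hk hB
  · rw [Input.card_allVisits]
    have := mul_le_mul_of_nonneg_left hsq
      (show 0 ≤ 5.2 * √(θ.nBar τ h k B : ℝ) by positivity)
    linarith

theorem integral_sub_le_of_wasserstein_le {X : Type*} [MetricSpace X] [MeasurableSpace X]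
    {μ ν : Measure X} {r : ℝ} (hr : 0 ≤ r) (h : wasserstein μ ν ≤ ENNReal.ofReal r) {f : X → ℝ}
    (hf : LipschitzWith 1 f) : (∫ x, f x ∂μ) - ∫ x, f x ∂ν ≤ r :=
  (ENNReal.ofReal_le_ofReal_iff hr).1 ((le_iSup₂ (f := fun (f : X → ℝ) (_ : LipschitzWith 1 f) =>
    ENNReal.ofReal ((∫ x, f x ∂μ) - ∫ x, f x ∂ν)) f hf).trans h)

/-- Bias part of the bound. A play in `B' ⊇ B` and the point `p ∈ B` both lie in `B'`, so their
transition laws differ by at most `L_T 2^(-ℓ(B'))`; this is then averaged over the plays. -/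
theorem integral_tBarMeasure_sub_le [BorelSpace S] {θ : Input S A} {M : MDP S A}
    {ρ : Run Ω S A} {ω : Ω} {h k : ℕ} (hH : 1 ≤ θ.H) (hLT : 0 ≤ θ.LT)
    (hLip : ∀ p q : S × A,
      wasserstein (M.T h p) (M.T h q) ≤ ENNReal.ofReal (θ.LT * θ.metric.D p q))
    (hsel : ∀ k < θ.K, (ρ.traj ω).ball (k + 1) h ∈ θ.partition (ρ.traj ω) h k)
    (hst : ∀ k ∈ Finset.Icc 1 θ.K, ρ.X k h ω ∈ (ρ.B k h ω).st)
    (hk1 : 1 ≤ k) (hk : k ≤ θ.K) {B : Ball S A} (hB : B ∈ θ.partition (ρ.traj ω) h k)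
    {p : S × A} (hp : p ∈ B.carrier) {f : S → ℝ} (hf : LipschitzWith 1 f) :
    (∫ y, f y ∂(θ.tBarMeasure (ρ.traj ω) h k B)) - ∫ y, f y ∂(M.T h p) ≤
      deviation (θ.allVisits (ρ.traj ω) h k B) (fun k' => ρ.X k' (h + 1) ω)
        (Run.nextLaw θ M ρ h ω) f / θ.nBar (ρ.traj ω) h k B +
      (4 * θ.LT + 4) * (1 / 2) ^ B.lvl := by
  set τ := ρ.traj ω with hτ
  have hN : (0 : ℝ) < θ.nBar τ h k B := by
    exact_mod_cast Input.one_le_nBar hsel hk1 hk hB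
  set N : ℝ := ((θ.nBar τ h k B : ℕ) : ℝ) with hNdef
  have hcard : ((θ.allVisits τ h k B).card : ℝ) = N := by rw [Input.card_allVisits]
  have h1 := Input.integral_tBarMeasure_le (θ := θ) τ h k (B := B) hf
  have h2 := Input.sum_allVisits_pow_le hH hsel hk hB
  have h3 : ∀ k' ∈ θ.allVisits τ h k B, ∫ y, f y ∂(Run.nextLaw θ M ρ h ω k') ≤
      ∫ y, f y ∂(M.T h p) + θ.LT * (1 / 2) ^ (τ.ball k' h).lvl := by
    intro k' hk'
    obtain ⟨h4, h5⟩ := Finset.mem_filter.1 hk'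
    have h6 := Finset.mem_Icc.1 h4
    obtain ⟨k'', rfl⟩ : ∃ k'', k' = k'' + 1 := ⟨k' - 1, by omega⟩
    have hnode : τ.ball (k'' + 1) h ∈ θ.nodes (τ.ball (k'' + 1) h).lvl :=
      Input.mem_nodes_of_mem_partition hsel (by omega) (hsel k'' (by omega))
    have hmem : (ρ.X (k'' + 1) h ω, θ.action (ρ.B (k'' + 1) h ω)) ∈
        (τ.ball (k'' + 1) h).carrier :=
      ⟨hst _ (Finset.mem_Icc.2 ⟨by omega, by omega⟩),
        θ.partA.center_mem _ _ (Input.mem_nodes.1 hnode).2.2⟩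
    have hp' : p ∈ (τ.ball (k'' + 1) h).carrier := (Finset.mem_filter.1 h5).2 hp
    have h7 := integral_sub_le_of_wasserstein_le
      (mul_nonneg hLT (θ.metric.nonneg _ _))
      (hLip (ρ.X (k'' + 1) h ω, θ.action (ρ.B (k'' + 1) h ω)) p) hf
    have h8 := mul_le_mul_of_nonneg_left (Input.metric_le hnode hmem hp') hLT
    change ∫ y, f y ∂(M.T h (ρ.X (k'' + 1) h ω, θ.action (ρ.B (k'' + 1) h ω))) ≤ _
    linarith
  have h4 := Finset.sum_le_sum h3
  rw [Finset.sum_add_distrib, Finset.sum_const, nsmul_eq_mul, hcard, ← Finset.mul_sum] at h4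
  rw [Finset.sum_add_distrib] at h1
  have h5 := mul_le_mul_of_nonneg_left h2 hLT
  rw [sub_le_iff_le_add]
  refine h1.trans ?_
  rw [div_le_iff₀ hN, deviation, Finset.sum_sub_distrib, add_mul, add_mul, div_mul_cancel₀ _ hN.ne']
  have h6 : ∑ k' ∈ θ.allVisits τ h k B, f (τ.st k' (h + 1)) =
    ∑ k' ∈ θ.allVisits τ h k B, f (ρ.X k' (h + 1) ω) := rfl
  linarith

theorem wasserstein_tBarMeasure_le [BorelSpace S] [CompactSpace S] {θ : Input S A} {M : MDP S A}
    {ρ : Run Ω S A} {ω : Ω} {h k : ℕ} (hc : θ.c = 300) (hδ0 : 0 < θ.δ) (hδ1 : θ.δ < 1)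
    (hLV : 0 < θ.LV) (hH : 1 ≤ θ.H) (hLT : 0 ≤ θ.LT)
    (hLip : ∀ p q : S × A,
      wasserstein (M.T h p) (M.T h q) ≤ ENNReal.ofReal (θ.LT * θ.metric.D p q))
    (hsel : ∀ k < θ.K, (ρ.traj ω).ball (k + 1) h ∈ θ.partition (ρ.traj ω) h k)
    (hst : ∀ k ∈ Finset.Icc 1 θ.K, ρ.X k h ω ∈ (ρ.B k h ω).st)
    (hdev : ∀ t ∈ Finset.Icc 1 θ.K, ∀ j ≤ θ.K, ∀ T ⊆ θ.partS.cells j,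
      setDeviation (Run.revisits θ ρ h t k ω) (fun k' => ρ.X k' (h + 1) ω)
        (Run.nextLaw θ M ρ h ω) (⋃ C ∈ T, C) ≤
      √((Run.revisits θ ρ h t k ω).card *
        (2 * Real.log (θ.H * θ.K ^ 2 / θ.δ) + (θ.partS.cells j).card) / 2))
    (hk1 : 1 ≤ k) (hk : k ≤ θ.K) {B : Ball S A} (hB : B ∈ θ.partition (ρ.traj ω) h k)
    {p : S × A} (hp : p ∈ B.carrier) :
    wasserstein (θ.tBarMeasure (ρ.traj ω) h k B) (M.T h p) ≤
      ENNReal.ofReal (1 / θ.LV * θ.tBonus (ρ.traj ω) h k B) := by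
  refine iSup₂_le fun f hf => ENNReal.ofReal_le_ofReal ?_
  have hmain := integral_tBarMeasure_sub_le hH hLT hLip hsel hst hk1 hk hB hp hf
  set L := Real.log (θ.H * θ.K ^ 2 / θ.δ) with hL
  have hL0 : 0 ≤ L := log_confidence_nonneg hH (by omega) hδ0 hδ1
  have hvar := fun j (hj : j ≤ θ.K) =>
    variation_allVisits_le (M := M) hL0 hH hsel hk hB (fun t ht => hdev t ht j hj)
  set τ := ρ.traj ω with hτ
  have hnode := Input.mem_nodes_of_mem_partition hsel hk hB
  have hN1 := Input.one_le_nBar hsel hk1 hk hB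
  have hNK : θ.nBar τ h k B ≤ θ.K := (Input.nBar_le θ τ h k B).trans hk
  have hlvl := Input.lvl_le_nBar hsel hk hB
  have hN : (0 : ℝ) < θ.nBar τ h k B := by exact_mod_cast hN1
  have hD : (0 : ℝ) < (1 / 2) ^ B.lvl := by positivity
  have hLTD := mul_nonneg hLT hD.le
  refine hmain.trans ?_
  rw [Input.tBonus, Input.diam_eq hnode, hc, ← hL]
  split_ifs with hd
  · rw [one_div θ.LV, inv_mul_cancel_left₀ hLV.ne']
    have h1 := θ.partS.deviation_le_chaining (θ.allVisits τ h k B) (fun k' => ρ.X k' (h + 1) ω)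
      (Run.nextLaw θ M ρ h ω) hf hd (by rwa [Input.card_allVisits]) (l := L)
      (fun j hj => hvar j (by rw [Input.card_allVisits] at hj; omega))
    rw [Input.card_allVisits] at h1
    have h2 := (div_le_iff₀' hN).2 h1
    linarith
  -- Discretizing at the single scale `ℓ(B)` adds `2 D(B)` to the bias `4 D(B)`, hence the `6` in
  -- the bonus.
  · rw [one_div θ.LV, inv_mul_cancel_left₀ hLV.ne']
    have h1 := θ.partS.deviation_le_of_variation (θ.allVisits τ h k B)
      (fun k' => ρ.X k' (h + 1) ω) (Run.nextLaw θ M ρ h ω) hf rfl B.lvl (hvar B.lvl (by omega))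
    rw [Input.card_allVisits] at h1
    set N : ℝ := ((θ.nBar τ h k B : ℕ) : ℝ) with hNdef
    have hcells : ((θ.partS.cells B.lvl).card : ℝ) = (2 : ℝ) ^ (θ.dS * (B.lvl : ℝ)) := by
      rw [θ.partS.card_cells, Real.rpow_mul (by norm_num), Real.rpow_natCast]
    rw [hcells] at h1
    set c : ℝ := (2 : ℝ) ^ (θ.dS * (B.lvl : ℝ)) with hcdef
    have hsq : ∀ x : ℝ, √N * √x = N * √(x / N) := by
      intro x
      rw [Real.sqrt_div' _ hN.le]
      have h3 := Real.mul_self_sqrt hN.le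
      have h0 : √N ≠ 0 := (Real.sqrt_pos.2 hN).ne'
      nth_rewrite 2 [← h3]
      field_simp
    have h2 : deviation (θ.allVisits τ h k B) (fun k' => ρ.X k' (h + 1) ω)
        (Run.nextLaw θ M ρ h ω) f ≤
        N * (2 * (1 / 2) ^ B.lvl + 2.6 * √(L / N) + 2.6 * √(c / N)) := by
      have e1 := hsq L
      have e2 := hsq c
      refine h1.trans (le_of_eq ?_)
      linear_combination 2.6 * e1 + 2.6 * e2
    have h3 := (div_le_iff₀' hN).2 h2
    have h4 := Real.sqrt_nonneg (L / N)
    have h5 := Real.sqrt_nonneg (c / N)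
    linarith

end AdaMB

theorem mainTheorem7 :
    ∃ c : ℝ, 0 < c ∧
      ∀ {S A Ω : Type*}
        [MetricSpace S] [CompactSpace S] [MeasurableSpace S] [BorelSpace S]
        [MetricSpace A] [CompactSpace A] [MeasurableSpace A] [BorelSpace A]
        [MeasurableSpace Ω] (μ : Measure Ω) [IsProbabilityMeasure μ]
        (θ : AdaMB.Input S A) (M : AdaMB.MDP S A) (ρ : AdaMB.Run Ω S A),
        θ.c = c → 0 < θ.δ → θ.δ < 1 → 0 < θ.LV → 0 ≤ θ.LT →
        (∀ h ∈ Finset.Icc 1 θ.H, ∀ p q : S × A,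
          AdaMB.wasserstein (M.T h p) (M.T h q) ≤ ENNReal.ofReal (θ.LT * θ.metric.D p q)) →
        AdaMB.IsRun θ M μ ρ →
        ∃ E : Set Ω, MeasurableSet E ∧ 1 - 2 * θ.δ ≤ μ.real E ∧
          ∀ ω ∈ E, ∀ h ∈ Finset.Icc 1 θ.H, ∀ k ∈ Finset.Icc 1 θ.K,
            ∀ B ∈ θ.partition (ρ.traj ω) h k, ∀ x a, (x, a) ∈ B.carrier →
              AdaMB.wasserstein (θ.tBarMeasure (ρ.traj ω) h k B) (M.T h (x, a)) ≤
                ENNReal.ofReal (1 / θ.LV * θ.tBonus (ρ.traj ω) h k B) := by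
  refine ⟨300, by norm_num, ?_⟩
  intro S A Ω _ _ _ _ _ _ _ _ _ μ _ θ M ρ hc hδ0 hδ1 hLV hLT hLip hrun
  obtain ⟨E, hE, hEμ, hgood⟩ := hrun.exists_event hδ0 hδ1
  refine ⟨E, hE, hEμ, fun ω hω h hh k hk B hB x a hxa => ?_⟩
  obtain ⟨hgreedy, hdev⟩ := hgood ω hω
  have hk' := Finset.mem_Icc.1 hk
  refine AdaMB.wasserstein_tBarMeasure_le hc hδ0 hδ1 hLV ?_ hLT (hLip h hh) ?_ ?_
    (fun t ht j hj T hT => hdev h hh t ht k hk j hj T hT) hk'.1 hk'.2 hB hxa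
  · have := Finset.mem_Icc.1 hh
    omega
  · intro i hi
    exact (hgreedy (i + 1) (Finset.mem_Icc.2 ⟨by omega, by omega⟩) h hh).1.1
  · intro i hi
    obtain ⟨b, hb⟩ := (hgreedy i hi h hh).1.2
    exact hb.1
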